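/- Let $d\in\{2,3\}$, let $\Omega\subset\mathbb R^d$ be a bounded domain whose boundary is of class $C^{1,1}$, or which is a convex polygon (polyhedron), let $\alpha>0$ be a constant, and let $(\varphi^n)_{n\in\mathbb N}$ be a sequence in $H^{-1/2}(\partial\Omega)$ whose linear span is dense. For coefficients $(a,c)$ and $\lambda\ge0$ let $u^{\lambda,n}\in H^1(\Omega)$ be the weak solution of $-\nabla\cdot(a\nabla u)+(c-\lambda)u=0$ in $\Omega$ with Neumann data $\varphi^n$, that is, $$\int_\Omega \bigl(a\nabla u^{\lambda,n}\cdot\nabla w+(c-\lambda)u^{\lambda,n}w\bigr)\,dx=\langle\varphi^n,\operatorname{tr}_{\partial\Omega}w\rangle\qquad\forall w\in H^1(\Omega),$$ and let $\mathbf F(a,c)=(\operatorname{tr}_{\partial\Omega}u^{\lambda,n})_{\lambda,n}$ collect the values $\Lambda_\lambda\varphi^n$ of the Neumann-to-Dirichlet maps. Linearize at $q_0=(a_0,c_0)$ with $a_0\equiv\alpha$, $c_0\equiv0$, and call $\lambda\geq 0$ regular if $-\nabla\cdot(a_0\nabla\,\cdot)+c_0-\lambda$ (weak form, Neumann boundary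 condition) is an isomorphism from $H^1(\Omega)$ onto $H^1(\Omega)^*$. For regular $\lambda$, the component of $\mathbf F'(q_0)(a,c)$ with index $(\lambda,n)$ is $\operatorname{tr}_{\partial\Omega}\dot u^{\lambda,n}$, where $u_0^{\lambda,n}$ is the state for $q_0$ and $\dot u^{\lambda,n}\in H^1(\Omega)$ satisfies $$\int_\Omega \bigl(a_0\nabla \dot u^{\lambda,n}\cdot\nabla w+(c_0-\lambda)\dot u^{\lambda,n}w\bigr)\,dx+\int_\Omega \bigl(a\nabla u_0^{\lambda,n}\cdot\nabla w+c\,u_0^{\lambda,n}w\bigr)\,dx=0\qquad\forall w\in H^1(\Omega).$$ (i) If $a\in L^\infty(\Omega)$ and $c\in L^2(\Omega)$ depend on $x$ only and $\operatorname{tr}_{\partial\Omega}\dot u^{\lambda,n}=0$ for all regular $\lambda\ge0$ and all $n\in\mathbb N$, then $a=0$ and $c=0$. (ii) Extend the absorption coefficient to functions $c:J\to L^2(\Omega)$ on $J=[0,\infty)\times\mathbb N$ (with $\mathbb N=\{1,2,\dots\}$) that are square integrable with respect to the weight $(1+\kappa)^{-2}\ell^{-2}$ times the product of Lebesgue and counting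 measure, where now $c(\lambda,n)$ is used in the problem with index $(\lambda,n)$, and let $$(Pc)(\lambda,n)=c(\lambda,n)-\frac{\sum_{\ell\in\mathbb N}\ell^{-2}\int_0^\infty(1+\kappa)^{-2}c(\kappa,\ell)\,d\kappa}{\sum_{\ell\in\mathbb N}\ell^{-2}\int_0^\infty(1+\kappa)^{-2}\,d\kappa}.$$ Let $\mathcal N(\mathbf F'(q_0))$ be the set of pairs $(a,c)$, with $a\in L^\infty(\Omega)$ and $c$ as above, for which the component of $\mathbf F'(q_0)(a,c)$ with index $(\lambda,n)$ vanishes for almost every $(\lambda,n)\in J$ with $\lambda$ regular, and let $\mathcal N(P)$ be the set of those pairs with $Pc=0$. Then $$\mathcal N(\mathbf F'(q_0))\cap\mathcal N(P)=\{0\}.$$ -/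

import Mathlib

open MeasureTheory Set
open scoped ENNReal ContDiff RealInnerProductSpace

noncomputable section

namespace DiffAbs

/-! ## Domains -/

/-- Euclidean space `ℝ^d`. -/
abbrev E (d : ℕ) : Type := EuclideanSpace ℝ (Fin d)

/-- The boundary of `Ω` is of class `C^{1,1}`: near each boundary point, and after choosing a unit
vector `ν` as the vertical direction, `Ω` is the region above the graph of a differentiable function
of the horizontal part `x - ⟪ν, x⟫ ν` whose derivative is Lipschitz continuous. -/
def HasC11Boundary {d : ℕ} (Ω : Set (E d)) : Prop :=
  ∀ x₀ ∈ frontier Ω, ∃ (U : Set (E d)) (ν : E d) (γ : E d → ℝ) (K : NNReal),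
    IsOpen U ∧ x₀ ∈ U ∧ ‖ν‖ = 1 ∧ Differentiable ℝ γ ∧ LipschitzWith K (fderiv ℝ γ) ∧
      ∀ x ∈ U, (x ∈ Ω ↔ γ (x - ⟪ν, x⟫ • ν) < ⟪ν, x⟫)

/-- `Ω` is a convex polygon (polyhedron): the interior of the convex hull of finitely many points. -/
def IsConvexPolytope {d : ℕ} (Ω : Set (E d)) : Prop :=
  ∃ V : Finset (E d), Ω = interior (convexHull ℝ (V : Set (E d)))

/-- A bounded domain (nonempty, open, connected) whose boundary is of class `C^{1,1}`, or which is
polygonal and convex. -/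
structure IsAdmissibleDomain {d : ℕ} (Ω : Set (E d)) : Prop where
  isOpen : IsOpen Ω
  isConnected : IsConnected Ω
  isBounded : Bornology.IsBounded Ω
  boundary : HasC11Boundary Ω ∨ IsConvexPolytope Ω

/-! ## The spaces `L²(Ω)`, `L^∞(Ω)`, `H¹(Ω)`, `H¹₀(Ω)`, `H^{1/2}(∂Ω)` and `H^{-1/2}(∂Ω)` -/

/-- Lebesgue measure on `Ω`. -/
abbrev vol {d : ℕ} (Ω : Set (E d)) : Measure (E d) := volume.restrict Ω

/-- `L²(Ω)`. -/
abbrev L2 {d : ℕ} (Ω : Set (E d)) : Type := Lp ℝ 2 (vol Ω)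

/-- `L^∞(Ω)`. -/
abbrev Linf {d : ℕ} (Ω : Set (E d)) : Type := Lp ℝ ∞ (vol Ω)

/-- `ψ` is a test function on `Ω`, that is, `ψ ∈ C_c^∞(Ω)`. -/
def IsTest {d : ℕ} (Ω : Set (E d)) (ψ : E d → ℝ) : Prop :=
  ContDiff ℝ ∞ ψ ∧ HasCompactSupport ψ ∧ tsupport ψ ⊆ Ω

/-- The vector field `g` is the weak gradient of `u` on `Ω`. -/
def IsWeakGradient {d : ℕ} (Ω : Set (E d)) (u : L2 Ω) (g : Lp (E d) 2 (vol Ω)) : Prop :=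
  ∀ ψ : E d → ℝ, IsTest Ω ψ → ∀ v : E d,
    ∫ x in Ω, u x * fderiv ℝ ψ x v = - ∫ x in Ω, ⟪g x, v⟫ * ψ x

theorem IsTest.memLp {d : ℕ} {Ω : Set (E d)} {ψ : E d → ℝ} (h : IsTest Ω ψ) :
    MemLp ψ 2 (vol Ω) :=
  (h.1.continuous.memLp_of_hasCompactSupport h.2.1).restrict Ω

theorem IsTest.memLp_fderiv {d : ℕ} {Ω : Set (E d)} {ψ : E d → ℝ} (h : IsTest Ω ψ) (v : E d) :
    MemLp (fun x => fderiv ℝ ψ x v) 2 (vol Ω) := by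
  have hc : Continuous (fun x => fderiv ℝ ψ x v) :=
    (h.1.continuous_fderiv (by simp)).clm_apply continuous_const
  exact (hc.memLp_of_hasCompactSupport (h.2.1.fderiv_apply ℝ v)).restrict Ω

theorem IsTest.integrable_left {d : ℕ} {Ω : Set (E d)} {ψ : E d → ℝ} (h : IsTest Ω ψ) (v : E d)
    (u : L2 Ω) : Integrable (fun x => u x * fderiv ℝ ψ x v) (vol Ω) :=
  (Lp.memLp u).integrable_mul (h.memLp_fderiv v)

theorem IsTest.integrable_right {d : ℕ} {Ω : Set (E d)} {ψ : E d → ℝ} (h : IsTest Ω ψ) (v : E d)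
    (g : Lp (E d) 2 (vol Ω)) : Integrable (fun x => ⟪g x, v⟫ * ψ x) (vol Ω) :=
  ((Lp.memLp g).inner_const v).integrable_mul h.memLp

theorem IsWeakGradient.zero {d : ℕ} (Ω : Set (E d)) : IsWeakGradient Ω 0 0 := by
  intro ψ _ v
  have h1 : (fun x => (0 : L2 Ω) x * fderiv ℝ ψ x v) =ᵐ[vol Ω] fun _ => (0 : ℝ) := by
    filter_upwards [Lp.coeFn_zero ℝ 2 (vol Ω)] with x hx
    rw [hx]
    simp
  have h2 : (fun x => ⟪(0 : Lp (E d) 2 (vol Ω)) x, v⟫ * ψ x) =ᵐ[vol Ω] fun _ => (0 : ℝ) := by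
    filter_upwards [Lp.coeFn_zero (E d) 2 (vol Ω)] with x hx
    rw [hx]
    simp
  rw [integral_congr_ae h1, integral_congr_ae h2]
  simp

theorem IsWeakGradient.add {d : ℕ} {Ω : Set (E d)} {u u' : L2 Ω} {g g' : Lp (E d) 2 (vol Ω)}
    (h : IsWeakGradient Ω u g) (h' : IsWeakGradient Ω u' g') :
    IsWeakGradient Ω (u + u') (g + g') := by
  intro ψ hψ v
  have h1 : (fun x => (u + u') x * fderiv ℝ ψ x v) =ᵐ[vol Ω]
      fun x => u x * fderiv ℝ ψ x v + u' x * fderiv ℝ ψ x v := by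
    filter_upwards [Lp.coeFn_add u u'] with x hx
    rw [hx, Pi.add_apply, add_mul]
  have h2 : (fun x => ⟪(g + g') x, v⟫ * ψ x) =ᵐ[vol Ω]
      fun x => ⟪g x, v⟫ * ψ x + ⟪g' x, v⟫ * ψ x := by
    filter_upwards [Lp.coeFn_add g g'] with x hx
    rw [hx, Pi.add_apply, inner_add_left, add_mul]
  rw [integral_congr_ae h1, integral_congr_ae h2,
    integral_add (hψ.integrable_left v u) (hψ.integrable_left v u'),
    integral_add (hψ.integrable_right v g) (hψ.integrable_right v g'), h ψ hψ v, h' ψ hψ v]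
  ring

theorem IsWeakGradient.smul {d : ℕ} {Ω : Set (E d)} {u : L2 Ω} {g : Lp (E d) 2 (vol Ω)} (r : ℝ)
    (h : IsWeakGradient Ω u g) : IsWeakGradient Ω (r • u) (r • g) := by
  intro ψ hψ v
  have h1 : (fun x => (r • u) x * fderiv ℝ ψ x v) =ᵐ[vol Ω]
      fun x => r * (u x * fderiv ℝ ψ x v) := by
    filter_upwards [Lp.coeFn_smul r u] with x hx
    rw [hx, Pi.smul_apply, smul_eq_mul, mul_assoc]
  have h2 : (fun x => ⟪(r • g) x, v⟫ * ψ x) =ᵐ[vol Ω] fun x => r * (⟪g x, v⟫ * ψ x) := by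
    filter_upwards [Lp.coeFn_smul r g] with x hx
    rw [hx, Pi.smul_apply, real_inner_smul_left, mul_assoc]
  rw [integral_congr_ae h1, integral_congr_ae h2, integral_const_mul, integral_const_mul,
    h ψ hψ v]
  ring

/-- The Sobolev space `H¹(Ω)`, as the pairs of an `L²` function and its weak gradient in `L²`, with
the norm `(‖u‖² + ‖∇u‖²)^{1/2}`. -/
def H1 {d : ℕ} (Ω : Set (E d)) : Submodule ℝ (WithLp 2 (L2 Ω × Lp (E d) 2 (vol Ω))) where
  carrier := {p | IsWeakGradient Ω p.fst p.snd}
  zero_mem' := IsWeakGradient.zero Ω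
  add_mem' h h' := IsWeakGradient.add h h'
  smul_mem' r _ h := IsWeakGradient.smul r h

/-- The underlying `L²` function of an element of `H¹(Ω)`. -/
def val {d : ℕ} {Ω : Set (E d)} (u : H1 Ω) : L2 Ω := (u : WithLp 2 (L2 Ω × Lp (E d) 2 (vol Ω))).fst

/-- The weak gradient of an element of `H¹(Ω)`. -/
def grad {d : ℕ} {Ω : Set (E d)} (u : H1 Ω) : Lp (E d) 2 (vol Ω) :=
  (u : WithLp 2 (L2 Ω × Lp (E d) 2 (vol Ω))).snd

/-- `H¹₀(Ω)`: the closed subspace of `H¹(Ω)` generated by the test functions. -/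
def H10 {d : ℕ} (Ω : Set (E d)) : Submodule ℝ (H1 Ω) :=
  (Submodule.span ℝ {u : H1 Ω | ∃ ψ : E d → ℝ, IsTest Ω ψ ∧ val u =ᵐ[vol Ω] ψ}).topologicalClosure

/-- The trace space `H^{1/2}(∂Ω)`, realised as `H¹(Ω) / H¹₀(Ω)` with the quotient norm
`‖g‖ = inf {‖u‖_{H¹(Ω)} : tr u = g}`. -/
abbrev TraceSpace {d : ℕ} (Ω : Set (E d)) : Type := H1 Ω ⧸ H10 Ω

/-- The trace operator `tr_{∂Ω} : H¹(Ω) → H^{1/2}(∂Ω)`. -/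
def tr {d : ℕ} {Ω : Set (E d)} (u : H1 Ω) : TraceSpace Ω := (H10 Ω).mkQ u

/-- `H^{-1/2}(∂Ω)`, the dual space of `H^{1/2}(∂Ω)`. -/
abbrev HMinusHalf {d : ℕ} (Ω : Set (E d)) : Type := TraceSpace Ω →L[ℝ] ℝ

/-! ## The forward problem and its linearization -/

/-- The weak form `∫_Ω (a ∇u·∇w + (c - lam) u w) dx` of `-∇·(a∇u) + (c - lam) u`. -/
def form {d : ℕ} (Ω : Set (E d)) (a c : E d → ℝ) (lam : ℝ) (u w : H1 Ω) : ℝ :=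
  ∫ x in Ω, (a x * ⟪grad u x, grad w x⟫ + (c x - lam) * val u x * val w x)

/-- The operator `-∇·(a∇ ·) + (c - lam)` with its natural boundary condition is an isomorphism from
`H¹(Ω)` onto its dual; for such `lam` the Neumann-to-Dirichlet map `Λ_lam` is well defined. -/
def IsRegular {d : ℕ} (Ω : Set (E d)) (a c : E d → ℝ) (lam : ℝ) : Prop :=
  ∀ ℓ : H1 Ω →L[ℝ] ℝ, ∃! u : H1 Ω, ∀ w : H1 Ω, form Ω a c lam u w = ℓ w

/-- `u` is the weak solution of `-∇·(a∇u) + (c - lam) u = 0` in `Ω` with Neumann data `φ`. -/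
def IsState {d : ℕ} (Ω : Set (E d)) (a c : E d → ℝ) (lam : ℝ) (φ : HMinusHalf Ω) (u : H1 Ω) :
    Prop :=
  ∀ w : H1 Ω, form Ω a c lam u w = φ (tr w)

/-- `du` is the derivative at `(a₀, c₀)`, in the direction `(da, dc)`, of the state, whose value at
`(a₀, c₀)` is `u₀`. -/
def IsLinearizedState {d : ℕ} (Ω : Set (E d)) (a₀ c₀ : E d → ℝ) (lam : ℝ) (u₀ : H1 Ω)
    (da dc : E d → ℝ) (du : H1 Ω) : Prop :=
  ∀ w : H1 Ω, form Ω a₀ c₀ lam du w +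
    ∫ x in Ω, (da x * ⟪grad u₀ x, grad w x⟫ + dc x * val u₀ x * val w x) = 0

/-- `g = tr_{∂Ω} (S^{lam,φ})'(a₀, c₀)(da, dc)`: the derivative at `(a₀, c₀)`, in the direction
`(da, dc)`, of `(a, c) ↦ Λ_lam φ`, where `Λ_lam` is the Neumann-to-Dirichlet map of
`-∇·(a∇u) + (c - lam) u = 0`. -/
def IsLinearizedData {d : ℕ} (Ω : Set (E d)) (a₀ c₀ : E d → ℝ) (lam : ℝ) (φ : HMinusHalf Ω)
    (da dc : E d → ℝ) (g : TraceSpace Ω) : Prop :=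
  ∃ u₀ du : H1 Ω, IsState Ω a₀ c₀ lam φ u₀ ∧ IsLinearizedState Ω a₀ c₀ lam u₀ da dc du ∧ tr du = g

/-! ## The extended parameter space, the forward operator's nullspace, and the penalty -/

/-- The weight `(1 + κ)^{-2} ℓ^{-2}` on `J = [0,∞) × ℕ`; the natural number `n` stands for
`ℓ = n + 1`. -/
def weight (j : ℝ × ℕ) : ℝ := ((1 + j.1) ^ 2)⁻¹ * (((j.2 : ℝ) + 1) ^ 2)⁻¹

/-- The measure on `J = [0,∞) × ℕ` with density `weight` with respect to the product of Lebesgue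
and counting measure. -/
def wmeas : Measure (ℝ × ℕ) :=
  ((volume.restrict (Ici (0 : ℝ))).prod Measure.count).withDensity
    (fun j => ENNReal.ofReal (weight j))

theorem integrable_weight :
    Integrable weight ((volume.restrict (Ici (0 : ℝ))).prod Measure.count) := by
  have h1 : Integrable (fun κ : ℝ => ((1 + κ) ^ 2)⁻¹) (volume.restrict (Ici (0 : ℝ))) := by
    have h := integrable_inv_one_add_sq.restrict (s := Ici (0 : ℝ))
    refine h.mono' (by fun_prop) ?_
    filter_upwards [ae_restrict_mem measurableSet_Ici] with κ hκ
    have hκ' : (0 : ℝ) ≤ κ := hκ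
    rw [Real.norm_of_nonneg (by positivity)]
    gcongr
    nlinarith
  have h2 : Integrable (fun n : ℕ => (((n : ℝ) + 1) ^ 2)⁻¹) Measure.count := by
    rw [integrable_count_iff]
    have h := (summable_nat_add_iff 1).2 (Real.summable_nat_pow_inv.2 (one_lt_two))
    simpa using h.norm
  exact h1.mul_prod h2

instance : IsFiniteMeasure wmeas := isFiniteMeasure_withDensity_ofReal integrable_weight.2

/-- The space of `j`-dependent absorption coefficients `c : J → L²(Ω)`, square integrable with
respect to the weighted measure. -/
abbrev LiftedC {d : ℕ} (Ω : Set (E d)) : Type := Lp (L2 Ω) 2 wmeas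

/-- The penalty `(P c)(λ, n) = c(λ, n) - (∑_ℓ ℓ⁻² ∫ (1+κ)⁻² c(κ,ℓ) dκ) / (∑_ℓ ℓ⁻² ∫ (1+κ)⁻² dκ)`. -/
def penalty {d : ℕ} (Ω : Set (E d)) (c : LiftedC Ω) : LiftedC Ω :=
  c - Lp.const 2 wmeas ((∫ j, weight j ∂((volume.restrict (Ici (0 : ℝ))).prod Measure.count))⁻¹ •
    ∫ j, c j ∂wmeas)

/-- The nullspace of `P` in the space of pairs `q = (a, c)`; `P` only acts on `c`. -/
def nullP {d : ℕ} (Ω : Set (E d)) : Set (Linf Ω × LiftedC Ω) := {q | penalty Ω q.2 = 0}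

/-- The nullspace of `F'(a₀, c₀)` in the space of pairs `q = (a, c)`, where
`F(a, c)(lam, n) = Λ_lam φ_n`, and `Λ_lam` is the Neumann-to-Dirichlet map with diffusion `a` and
absorption `c(lam, n)`. -/
def nullF' {d : ℕ} (Ω : Set (E d)) (φ : ℕ → HMinusHalf Ω) (a₀ c₀ : E d → ℝ) :
    Set (Linf Ω × LiftedC Ω) :=
  {q | ∀ᵐ j ∂wmeas, IsRegular Ω a₀ c₀ j.1 →
    IsLinearizedData Ω a₀ c₀ j.1 (φ j.2) q.1 (q.2 j) 0}

end DiffAbs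

end

/-!
Write `μ = lam / α`. If the linearized data vanish for a regular `lam`, a duality argument
(`integral_eq_zero_of_isLinearizedData`) shows that `∫ (a ∇u·∇w + c u w) = 0` for all weak solutions
`u`, `w` of `-α Δu = lam u` in `Ω`; for one of the two factors only bounded functions with bounded
gradient are needed, which makes all integrals finite. For every frequency `ζ` there are two
exponential solutions whose product is the plane wave of frequency `ζ`
(`exists_frequencies`; this needs a direction orthogonal to `ζ`, hence dimension at least two), and
the identity becomes `ĉ(ζ) - (‖ζ‖² / 2 - μ) â(ζ) = 0` (`integral_mul_cos_eq_zero`). Two distinct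
regular values of `lam` therefore give `â = ĉ = 0`, and `a = c = 0`
(`eq_zero_of_isLinearizedData`).

It remains to see that there are enough regular `lam`. It is here that the shape of `Ω` enters. The
Poincaré inequality holds on `Ω` (`IsAdmissibleDomain.poincareOn`): each point of the closure has a
neighbourhood all of whose points in `Ω` are joined by segments within `Ω` to the points of a set
of positive measure, integration along these segments gives a local inequality, and the local
inequalities are chained together. Consequently all `lam` in an interval `(0, lam₀)` are regular
(`IsAdmissibleDomain.exists_isRegular`).

For coefficients that depend on the index, `P c = 0` says that `c` is constant in the index, and
since the weight is positive, almost every `lam` in `(0, lam₀)` provides the data of the first part.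
-/

noncomputable section

namespace DiffAbs

/-! ### Averages over segments -/

theorem lintegral_comp_smul_add {d : ℕ} {F : E d → ℝ≥0∞} (hF : Measurable F) {r : ℝ} (hr : r ≠ 0)
    (b : E d) :
    ∫⁻ x, F (r • x + b) = ENNReal.ofReal |(r ^ d)⁻¹| * ∫⁻ x, F x := by
  have h1 : ∫⁻ x, F (r • x + b) = ∫⁻ z, F (z + b) ∂(Measure.map (r • ·) volume) := by
    rw [lintegral_map (by fun_prop) (by fun_prop)]
  rw [h1, Measure.map_addHaar_smul _ hr, lintegral_smul_measure, lintegral_add_right_eq_self,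
    finrank_euclideanSpace_fin, smul_eq_mul]

theorem lintegral_segment_le {d : ℕ} {F : E d → ℝ≥0∞} (hF : Measurable F) (S : Set (E d))
    (I : Set ℝ) (hI : volume I ≤ 1) (hIm : MeasurableSet I) {r : ℝ → ℝ} (hrm : Measurable r)
    (hr : ∀ t ∈ I, 1 / 2 ≤ r t) (b : E d) :
    ∫⁻ x in S, ∫⁻ t in I, F (r t • x + (1 - r t) • b) ≤ 2 ^ d * ∫⁻ x, F x := by
  rw [lintegral_lintegral_swap (by fun_prop)]
  calc ∫⁻ t in I, ∫⁻ x in S, F (r t • x + (1 - r t) • b)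
      ≤ ∫⁻ _ in I, 2 ^ d * ∫⁻ x, F x := by
        refine setLIntegral_mono' hIm fun t ht => ?_
        have h0 : 0 < r t := by linarith [hr t ht]
        refine (setLIntegral_le_lintegral _ _).trans ?_
        rw [lintegral_comp_smul_add hF h0.ne']
        gcongr
        rw [abs_of_nonneg (by positivity), ← inv_pow, ENNReal.ofReal_pow (by positivity)]
        gcongr
        rw [← ENNReal.ofReal_ofNat]
        apply ENNReal.ofReal_le_ofReal
        rw [inv_le_comm₀ h0 (by norm_num)]
        simpa using hr t ht
    _ ≤ 2 ^ d * ∫⁻ x, F x := by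
        rw [setLIntegral_const]
        exact mul_le_of_le_one_right (by simp) hI

/-- The average of `F` over the segments joining `A` to `B` is controlled by the integral of `F`:
on the half of the segment that is closer to `A` the change of variables is made in the point
of `A`, on the other half in the point of `B`, so that its Jacobian is at least `2⁻ᵈ`. -/
theorem lintegral_segments_le {d : ℕ} {F : E d → ℝ≥0∞} (hF : Measurable F) (A B : Set (E d)) :
    ∫⁻ x in A, ∫⁻ y in B, ∫⁻ t in Icc (0 : ℝ) 1, F ((1 - t) • x + t • y) ≤
      (volume A + volume B) * (2 ^ d * ∫⁻ x, F x) := by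
  have key : ∀ x y : E d, ∫⁻ t in Icc (0 : ℝ) 1, F ((1 - t) • x + t • y) ≤
      (∫⁻ t in Icc (0 : ℝ) (1 / 2), F ((1 - t) • x + (1 - (1 - t)) • y)) +
        ∫⁻ t in Icc (1 / 2 : ℝ) 1, F (t • y + (1 - t) • x) := by
    intro x y
    rw [← Icc_union_Icc_eq_Icc (a := (0 : ℝ)) (b := 1 / 2) (c := 1) (by norm_num) (by norm_num)]
    refine (lintegral_union_le _ _ _).trans (le_of_eq ?_)
    simp only [sub_sub_cancel, add_comm]
  have hm1 : Measurable fun p : E d × E d =>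
      ∫⁻ t in Icc (0 : ℝ) (1 / 2), F ((1 - t) • p.1 + (1 - (1 - t)) • p.2) := by
    apply Measurable.lintegral_prod_right'
      (f := fun q : (E d × E d) × ℝ => F ((1 - q.2) • q.1.1 + (1 - (1 - q.2)) • q.1.2))
    fun_prop
  calc ∫⁻ x in A, ∫⁻ y in B, ∫⁻ t in Icc (0 : ℝ) 1, F ((1 - t) • x + t • y)
      ≤ ∫⁻ x in A, ((∫⁻ y in B, ∫⁻ t in Icc (0 : ℝ) (1 / 2),
            F ((1 - t) • x + (1 - (1 - t)) • y)) +
          ∫⁻ y in B, ∫⁻ t in Icc (1 / 2 : ℝ) 1, F (t • y + (1 - t) • x)) := by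
        refine lintegral_mono fun x => ?_
        refine (lintegral_mono fun y => key x y).trans (le_of_eq (lintegral_add_left ?_ _))
        exact hm1.comp (by fun_prop : Measurable fun y => (x, y))
    _ = (∫⁻ x in A, ∫⁻ y in B, ∫⁻ t in Icc (0 : ℝ) (1 / 2),
            F ((1 - t) • x + (1 - (1 - t)) • y)) +
          ∫⁻ x in A, ∫⁻ y in B, ∫⁻ t in Icc (1 / 2 : ℝ) 1, F (t • y + (1 - t) • x) := by
        exact lintegral_add_left (Measurable.lintegral_prod_right' hm1) _
    _ ≤ volume B * (2 ^ d * ∫⁻ x, F x) + volume A * (2 ^ d * ∫⁻ x, F x) := by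
        gcongr
        · rw [lintegral_lintegral_swap hm1.aemeasurable, mul_comm, ← setLIntegral_const]
          refine lintegral_mono fun y => lintegral_segment_le hF _ _ ?_ measurableSet_Icc
            (by fun_prop) ?_ y
          · rw [Real.volume_Icc]; exact ENNReal.ofReal_le_one.2 (by norm_num)
          · intro t ht; linarith [ht.2]
        · rw [mul_comm, ← setLIntegral_const]
          refine lintegral_mono fun x => lintegral_segment_le hF _ _ ?_ measurableSet_Icc
            measurable_id ?_ x
          · rw [Real.volume_Icc]; exact ENNReal.ofReal_le_one.2 (by norm_num)
          · intro t ht; exact ht.1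
    _ = _ := by ring

/-! ### Mollification -/

theorem sq_lintegral_le {X : Type*} [MeasurableSpace X] {μ : Measure X} [IsProbabilityMeasure μ]
    {f : X → ℝ≥0∞} (hf : AEMeasurable f μ) : (∫⁻ x, f x ∂μ) ^ 2 ≤ ∫⁻ x, f x ^ 2 ∂μ := by
  have h := ENNReal.lintegral_mul_le_Lp_mul_Lq μ Real.HolderConjugate.two_two hf
    (aemeasurable_const (b := (1 : ℝ≥0∞)))
  simp only [Pi.mul_apply, mul_one, ENNReal.one_rpow, lintegral_const, measure_univ] at h
  calc (∫⁻ x, f x ∂μ) ^ 2 ≤ ((∫⁻ x, f x ^ (2 : ℝ) ∂μ) ^ (1 / 2 : ℝ)) ^ 2 := by gcongr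
    _ = ∫⁻ x, f x ^ 2 ∂μ := by
      rw [← ENNReal.rpow_natCast, ← ENNReal.rpow_mul]
      norm_num

theorem enorm_sub_sq_le_lintegral_fderiv {d : ℕ} {v : E d → ℝ} (hv : ContDiff ℝ 1 v) (x y : E d) :
    ‖v x - v y‖ₑ ^ 2 ≤
      ∫⁻ t in Icc (0 : ℝ) 1, ‖fderiv ℝ v ((1 - t) • x + t • y) (x - y)‖ₑ ^ 2 := by
  have hc : Continuous fun t : ℝ => fderiv ℝ v ((1 - t) • x + t • y) (x - y) :=
    ((hv.continuous_fderiv (by simp)).comp (by fun_prop)).clm_apply continuous_const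
  have hd : ∀ t : ℝ, HasDerivAt (fun t : ℝ => v ((1 - t) • x + t • y))
      (-fderiv ℝ v ((1 - t) • x + t • y) (x - y)) t := by
    intro t
    have h1 : HasDerivAt (fun t : ℝ => (1 - t) • x + t • y) ((-1 : ℝ) • x + (1 : ℝ) • y) t :=
      (((hasDerivAt_id t).const_sub 1).smul_const x).add ((hasDerivAt_id t).smul_const y)
    have h2 := ((hv.differentiable (by simp)) _).hasFDerivAt.comp_hasDerivAt t h1
    refine h2.congr_deriv ?_
    rw [← map_neg, neg_one_smul, one_smul, neg_sub, neg_add_eq_sub]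
  have hint := intervalIntegral.integral_eq_sub_of_hasDerivAt (a := 0) (b := 1)
    (fun t _ => hd t) (hc.neg.intervalIntegrable _ _)
  have h3 : v x - v y = ∫ t in Icc (0 : ℝ) 1, fderiv ℝ v ((1 - t) • x + t • y) (x - y) := by
    rw [integral_Icc_eq_integral_Ioc, ← intervalIntegral.integral_of_le zero_le_one]
    rw [intervalIntegral.integral_neg] at hint
    simp only [sub_self, zero_smul, one_smul, zero_add, sub_zero, add_zero] at hint
    linarith
  have : IsProbabilityMeasure (volume.restrict (Icc (0 : ℝ) 1)) := ⟨by simp⟩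
  rw [h3]
  calc _ ≤ (∫⁻ t in Icc (0 : ℝ) 1, ‖fderiv ℝ v ((1 - t) • x + t • y) (x - y)‖ₑ) ^ 2 := by
        gcongr
        exact enorm_integral_le_lintegral_enorm _
    _ ≤ _ := sq_lintegral_le hc.enorm.measurable.aemeasurable

/-- The squared length of the weak gradient, extended by zero. -/
def gradSq {d : ℕ} {Ω : Set (E d)} (u : H1 Ω) : E d → ℝ≥0∞ :=
  Ω.indicator fun x => ‖grad u x‖ₑ ^ 2

theorem measurable_gradSq {d : ℕ} {Ω : Set (E d)} (hΩ : MeasurableSet Ω) (u : H1 Ω) :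
    Measurable (gradSq u) :=
  ((Lp.stronglyMeasurable (grad u)).measurable.enorm.pow_const 2).indicator hΩ

/-- The mollification of a Sobolev function, extended by zero. -/
def mollify {d : ℕ} {Ω : Set (E d)} (ρ : ContDiffBump (0 : E d)) (u : H1 Ω) : E d → ℝ :=
  convolution (ρ.normed volume) (Ω.indicator (val u)) (ContinuousLinearMap.lsmul ℝ ℝ) volume

/-- The mollification of the squared length of the weak gradient. -/
def mollifyGradSq {d : ℕ} {Ω : Set (E d)} (ρ : ContDiffBump (0 : E d)) (u : H1 Ω) (z : E d) :
    ℝ≥0∞ :=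
  ∫⁻ y, ENNReal.ofReal (ρ.normed volume (z - y)) * gradSq u y

theorem lintegral_ofReal_normed {d : ℕ} (ρ : ContDiffBump (0 : E d)) :
    ∫⁻ y, ENNReal.ofReal (ρ.normed volume y) = 1 := by
  rw [← ofReal_integral_eq_lintegral_ofReal ρ.integrable_normed
    (Filter.Eventually.of_forall ρ.nonneg_normed), ρ.integral_normed, ENNReal.ofReal_one]

theorem measurable_mollifyGradSq {d : ℕ} {Ω : Set (E d)} (hΩ : MeasurableSet Ω)
    (ρ : ContDiffBump (0 : E d)) (u : H1 Ω) : Measurable (mollifyGradSq ρ u) := by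
  have := measurable_gradSq hΩ u
  have h2 : Measurable (ρ.normed volume) := ρ.continuous_normed.measurable
  unfold mollifyGradSq
  apply Measurable.lintegral_prod_right'
    (f := fun q : E d × E d => ENNReal.ofReal (ρ.normed volume (q.1 - q.2)) * gradSq u q.2)
  fun_prop

theorem lintegral_mollifyGradSq {d : ℕ} {Ω : Set (E d)} (hΩ : MeasurableSet Ω)
    (ρ : ContDiffBump (0 : E d)) (u : H1 Ω) :
    ∫⁻ z, mollifyGradSq ρ u z = ∫⁻ x in Ω, ‖grad u x‖ₑ ^ 2 := by
  have h1 := measurable_gradSq hΩ u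
  have h2 : Measurable (ρ.normed volume) := ρ.continuous_normed.measurable
  unfold mollifyGradSq
  rw [lintegral_lintegral_swap (by fun_prop)]
  have : ∀ y, ∫⁻ z, ENNReal.ofReal (ρ.normed volume (z - y)) * gradSq u y = gradSq u y := by
    intro y
    rw [lintegral_mul_const _ (by fun_prop),
      lintegral_sub_right_eq_self (fun z => ENNReal.ofReal (ρ.normed volume z)) y,
      lintegral_ofReal_normed, one_mul]
  simp_rw [this]
  exact lintegral_indicator hΩ _

theorem locallyIntegrable_indicator_val {d : ℕ} {Ω : Set (E d)} (hΩ : MeasurableSet Ω)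
    (u : H1 Ω) : LocallyIntegrable (Ω.indicator (val u)) volume := by
  have h : MemLp (Ω.indicator (val u)) 2 volume :=
    (memLp_indicator_iff_restrict hΩ).2 (Lp.memLp (val u))
  exact h.locallyIntegrable (by norm_num)

theorem contDiff_mollify {d : ℕ} {Ω : Set (E d)} (hΩ : MeasurableSet Ω)
    (ρ : ContDiffBump (0 : E d)) (u : H1 Ω) : ContDiff ℝ 1 (mollify ρ u) :=
  ρ.hasCompactSupport_normed.contDiff_convolution_left _ (ρ.contDiff_normed (n := 1))
    (locallyIntegrable_indicator_val hΩ u)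

/-- At points whose distance to the boundary exceeds the radius of the mollifier, the derivative of
the mollification is the mollification of the weak gradient. -/
theorem fderiv_mollify {d : ℕ} {Ω : Set (E d)} (hΩ : MeasurableSet Ω)
    (ρ : ContDiffBump (0 : E d)) (u : H1 Ω) {z : E d} (hz : Metric.closedBall z ρ.rOut ⊆ Ω)
    (w : E d) :
    fderiv ℝ (mollify ρ u) z w = ∫ y in Ω, ⟪grad u y, w⟫ * ρ.normed volume (z - y) := by
  have hli := locallyIntegrable_indicator_val hΩ u
  have hρ1 : ContDiff ℝ 1 (ρ.normed volume) := ρ.contDiff_normed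
  have hρ : ContDiff ℝ ∞ (ρ.normed volume) := ρ.contDiff_normed
  have h1 := (ρ.hasCompactSupport_normed.hasFDerivAt_convolution_left
    (ContinuousLinearMap.lsmul ℝ ℝ) hρ1 hli z).fderiv
  have hex := (ρ.hasCompactSupport_normed (μ := volume)).fderiv (𝕜 := ℝ)
    |>.convolutionExists_left ((ContinuousLinearMap.lsmul ℝ ℝ).precompL (E d))
      (hρ1.continuous_fderiv (by simp)) hli z
  have htest : IsTest Ω fun y => ρ.normed volume (z - y) := by
    have hts : tsupport (fun y => ρ.normed volume (z - y)) ⊆ Metric.closedBall z ρ.rOut := by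
      refine closure_minimal (fun y hy => ?_) Metric.isClosed_closedBall
      have : z - y ∈ Function.support (ρ.normed volume) := hy
      rw [ρ.support_normed_eq] at this
      rw [Metric.mem_closedBall, dist_comm, dist_eq_norm]
      exact (mem_ball_zero_iff.1 this).le
    exact ⟨hρ.comp (contDiff_const.sub contDiff_id),
      HasCompactSupport.of_support_subset_isCompact (isCompact_closedBall z ρ.rOut)
        ((subset_tsupport _).trans hts), hts.trans hz⟩
  have hw := u.2 _ htest w
  have hfd : ∀ y, fderiv ℝ (fun y => ρ.normed volume (z - y)) y w
      = - fderiv ℝ (ρ.normed volume) (z - y) w := by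
    intro y
    have h2 : HasFDerivAt (fun y : E d => z - y) (-ContinuousLinearMap.id ℝ (E d)) y :=
      (hasFDerivAt_id y).const_sub z
    have h3 := (((hρ1.differentiable (by simp)) (z - y)).hasFDerivAt.comp y h2).fderiv
    have h4 : fderiv ℝ (fun y => ρ.normed volume (z - y)) y = _ := h3
    rw [h4]
    simp
  simp_rw [hfd] at hw
  have h5 : fderiv ℝ (mollify ρ u) z w =
      ∫ y in Ω, val u y * fderiv ℝ (ρ.normed volume) (z - y) w := by
    unfold mollify
    rw [h1, convolution, ContinuousLinearMap.integral_apply hex, ← integral_indicator hΩ,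
      ← integral_sub_left_eq_self _ _ z]
    congr 1
    ext t
    simp only [ContinuousLinearMap.precompL_apply, ContinuousLinearMap.lsmul_apply, smul_eq_mul,
      sub_sub_cancel]
    by_cases ht : t ∈ Ω
    · simp only [indicator_of_mem ht, mul_comm]
    · simp only [indicator_of_notMem ht, mul_zero]
  rw [h5]
  have h6 : ∫ y in Ω, (val u) y * -fderiv ℝ (ρ.normed volume) (z - y) w
    = - ∫ y in Ω, ⟪grad u y, w⟫ * ρ.normed volume (z - y) := hw
  simp only [mul_neg, integral_neg, neg_inj] at h6
  exact h6

theorem enorm_fderiv_mollify_sq_le {d : ℕ} {Ω : Set (E d)} (hΩ : MeasurableSet Ω)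
    (ρ : ContDiffBump (0 : E d)) (u : H1 Ω) {z : E d} (hz : Metric.closedBall z ρ.rOut ⊆ Ω)
    (w : E d) :
    ‖fderiv ℝ (mollify ρ u) z w‖ₑ ^ 2 ≤ ‖w‖ₑ ^ 2 * mollifyGradSq ρ u z := by
  have hρm : Measurable fun y => ENNReal.ofReal (ρ.normed volume (z - y)) :=
    (ρ.continuous_normed.measurable.comp (measurable_const.sub measurable_id)).ennreal_ofReal
  have hgm : Measurable fun y => ‖grad u y‖ₑ := (Lp.stronglyMeasurable (grad u)).measurable.enorm
  set ν := volume.withDensity fun y => ENNReal.ofReal (ρ.normed volume (z - y)) with hν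
  have : IsProbabilityMeasure ν := ⟨by
    rw [hν, withDensity_apply _ MeasurableSet.univ, Measure.restrict_univ,
      lintegral_sub_left_eq_self (fun y => ENNReal.ofReal (ρ.normed volume y)) z,
      lintegral_ofReal_normed]⟩
  have hm : Measurable (Ω.indicator fun y => ‖w‖ₑ * ‖grad u y‖ₑ) :=
    (hgm.const_mul _).indicator hΩ
  have h1 : ‖fderiv ℝ (mollify ρ u) z w‖ₑ ≤
      ∫⁻ y, Ω.indicator (fun y => ‖w‖ₑ * ‖grad u y‖ₑ) y ∂ν := by
    rw [fderiv_mollify hΩ ρ u hz, hν, lintegral_withDensity_eq_lintegral_mul _ hρm hm]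
    refine (enorm_integral_le_lintegral_enorm _).trans ?_
    rw [← lintegral_indicator hΩ]
    refine lintegral_mono fun y => ?_
    by_cases hy : y ∈ Ω
    · simp only [indicator_of_mem hy, Pi.mul_apply]
      rw [enorm_mul, mul_comm, Real.enorm_of_nonneg (ρ.nonneg_normed _)]
      gcongr
      rw [mul_comm]
      simpa [enorm_eq_nnnorm, ← ENNReal.coe_mul] using nnnorm_inner_le_nnnorm (𝕜 := ℝ) (grad u y) w
    · simp [indicator_of_notMem hy]
  calc _ ≤ (∫⁻ y, Ω.indicator (fun y => ‖w‖ₑ * ‖grad u y‖ₑ) y ∂ν) ^ 2 := by gcongr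
    _ ≤ ∫⁻ y, Ω.indicator (fun y => ‖w‖ₑ * ‖grad u y‖ₑ) y ^ 2 ∂ν := sq_lintegral_le hm.aemeasurable
    _ = _ := by
      rw [hν, lintegral_withDensity_eq_lintegral_mul _ hρm (hm.pow_const 2), mollifyGradSq,
        ← lintegral_const_mul _
          (f := fun y => ENNReal.ofReal (ρ.normed volume (z - y)) * gradSq u y)
          (hρm.mul (measurable_gradSq hΩ u))]
      congr 1
      ext y
      by_cases hy : y ∈ Ω
      · simp only [Pi.mul_apply, gradSq, indicator_of_mem hy]; ring
      · simp [gradSq, indicator_of_notMem hy]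

/-! ### The Poincaré inequality -/

theorem lintegral_lintegral_liminf_le {X Y : Type*} [MeasurableSpace X] [MeasurableSpace Y]
    {μ : Measure X} {ν : Measure Y} [SFinite ν] (f : ℕ → X → Y → ℝ≥0∞)
    (hf : ∀ n, Measurable fun p : X × Y => f n p.1 p.2) :
    ∫⁻ x, ∫⁻ y, Filter.liminf (fun n => f n x y) Filter.atTop ∂ν ∂μ ≤
      Filter.liminf (fun n => ∫⁻ x, ∫⁻ y, f n x y ∂ν ∂μ) Filter.atTop :=
  (lintegral_mono fun x => lintegral_liminf_le fun n =>
    (hf n).comp (by fun_prop : Measurable fun y => (x, y))).trans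
  (lintegral_liminf_le fun n => Measurable.lintegral_prod_right' (hf n))

/-- The integral of `F` along the segment from `x` to `y`, parametrized over the unit interval. -/
def segmentAverage {d : ℕ} (F : E d → ℝ≥0∞) (x y : E d) : ℝ≥0∞ :=
  ∫⁻ t in Icc (0 : ℝ) 1, F ((1 - t) • x + t • y)

theorem measurable_segmentAverage {d : ℕ} {F : E d → ℝ≥0∞} (hF : Measurable F) :
    Measurable fun p : E d × E d => segmentAverage F p.1 p.2 := by
  apply Measurable.lintegral_prod_right'
    (f := fun q : (E d × E d) × ℝ => F ((1 - q.2) • q.1.1 + q.2 • q.1.2))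
  fun_prop

theorem measurable_segmentAverage_right {d : ℕ} {F : E d → ℝ≥0∞} (hF : Measurable F) (x : E d) :
    Measurable fun y : E d => segmentAverage F x y := by
  apply Measurable.lintegral_prod_right'
    (f := fun q : E d × ℝ => F ((1 - q.2) • x + q.2 • q.1))
  fun_prop

theorem enorm_mollify_sub_sq_le {d : ℕ} {Ω : Set (E d)} (hΩ : MeasurableSet Ω)
    (ρ : ContDiffBump (0 : E d)) (u : H1 Ω) {x y : E d}
    (hxy : Metric.cthickening ρ.rOut (segment ℝ x y) ⊆ Ω) :
    ‖mollify ρ u x - mollify ρ u y‖ₑ ^ 2 ≤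
      ‖x - y‖ₑ ^ 2 * segmentAverage (mollifyGradSq ρ u) x y := by
  have hKc : Measurable fun t : ℝ => mollifyGradSq ρ u ((1 - t) • x + t • y) :=
    (measurable_mollifyGradSq hΩ ρ u).comp (by fun_prop)
  refine (enorm_sub_sq_le_lintegral_fderiv (contDiff_mollify hΩ ρ u) x y).trans ?_
  rw [segmentAverage, ← lintegral_const_mul _ hKc]
  refine setLIntegral_mono' measurableSet_Icc fun t ht => ?_
  have hmem : (1 - t) • x + t • y ∈ segment ℝ x y := by
    rw [segment_eq_image]
    exact ⟨t, ht, rfl⟩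
  exact enorm_fderiv_mollify_sq_le hΩ ρ u
    ((Metric.closedBall_subset_cthickening hmem _).trans hxy) _

theorem exists_mollifiers {d : ℕ} {Ω : Set (E d)} (hΩ : MeasurableSet Ω) (u : H1 Ω) :
    ∃ ρ : ℕ → ContDiffBump (0 : E d),
      Filter.Tendsto (fun n => (ρ n).rOut) Filter.atTop (nhds 0) ∧
      ∀ᵐ x : E d, Filter.Tendsto (fun n => mollify (ρ n) u x) Filter.atTop
        (nhds (Ω.indicator (val u) x)) := by
  let ρ : ℕ → ContDiffBump (0 : E d) := fun n =>
    ⟨1 / ((n : ℝ) + 1), 2 * (1 / ((n : ℝ) + 1)), by positivity, by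
      have : 0 < 1 / ((n : ℝ) + 1) := by positivity
      linarith⟩
  have hρ : Filter.Tendsto (fun n => (ρ n).rOut) Filter.atTop (nhds 0) := by
    simpa only [mul_zero] using (tendsto_one_div_add_atTop_nhds_zero_nat (𝕜 := ℝ)).const_mul 2
  exact ⟨ρ, hρ, ContDiffBump.ae_convolution_tendsto_right_of_locallyIntegrable (K := 2) hρ
    (Filter.Eventually.of_forall fun n => le_rfl) (locallyIntegrable_indicator_val hΩ u)⟩

/-- If every point of `A` sees every point of `B` within `Ω`, then the oscillation of a Sobolev
function between `A` and `B` is controlled by its weak gradient. The inequality is integrated along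
segments for the mollified function; the radius of the mollifier then tends to zero. -/
theorem lintegral_lintegral_sub_sq_le {d : ℕ} {Ω : Set (E d)} (hΩ : IsOpen Ω) (u : H1 Ω)
    {A B : Set (E d)} (hA : MeasurableSet A) (hB : MeasurableSet B)
    (hseg : ∀ x ∈ A, ∀ y ∈ B, segment ℝ x y ⊆ Ω) {D : ℝ≥0∞}
    (hD : ∀ x ∈ A, ∀ y ∈ B, ‖x - y‖ₑ ≤ D) :
    ∫⁻ x in A, ∫⁻ y in B, ‖val u x - val u y‖ₑ ^ 2 ≤
      D ^ 2 * ((volume A + volume B) * (2 ^ d * ∫⁻ x in Ω, ‖grad u x‖ₑ ^ 2)) := by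
  obtain ⟨ρ, hρ, hae⟩ := exists_mollifiers hΩ.measurableSet u
  have hK : ∀ n, Measurable (mollifyGradSq (ρ n) u) := fun n =>
    measurable_mollifyGradSq hΩ.measurableSet (ρ n) u
  have hm : ∀ n, Measurable fun p : E d × E d =>
      segmentAverage (mollifyGradSq (ρ n) u) p.1 p.2 := fun n => measurable_segmentAverage (hK n)
  have hmy : ∀ n (x : E d), Measurable fun y : E d => segmentAverage (mollifyGradSq (ρ n) u) x y :=
    fun n x => measurable_segmentAverage_right (hK n) x
  have hpt : ∀ x y : E d, x ∈ A → y ∈ B →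
      Filter.Tendsto (fun n => mollify (ρ n) u x) Filter.atTop (nhds (Ω.indicator (val u) x)) →
      Filter.Tendsto (fun n => mollify (ρ n) u y) Filter.atTop (nhds (Ω.indicator (val u) y)) →
      ‖val u x - val u y‖ₑ ^ 2 ≤ Filter.liminf (fun n => D ^ 2 *
        segmentAverage (mollifyGradSq (ρ n) u) x y) Filter.atTop := by
    intro x y hx hy hxl hyl
    rw [indicator_of_mem (hseg x hx y hy (left_mem_segment ℝ x y))] at hxl
    rw [indicator_of_mem (hseg x hx y hy (right_mem_segment ℝ x y))] at hyl
    have hlim : Filter.Tendsto (fun n => ‖mollify (ρ n) u x - mollify (ρ n) u y‖ₑ ^ 2)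
        Filter.atTop (nhds (‖val u x - val u y‖ₑ ^ 2)) :=
      ((ENNReal.continuous_pow 2).tendsto _).comp (hxl.sub hyl).enorm
    rw [← hlim.liminf_eq]
    refine Filter.liminf_le_liminf ?_
    have hcs : IsCompact (segment ℝ x y) := by
      rw [segment_eq_image]
      exact isCompact_Icc.image (by fun_prop)
    obtain ⟨δ, hδ, hsub⟩ := hcs.exists_cthickening_subset_open hΩ (hseg x hx y hy)
    filter_upwards [hρ.eventually_lt_const hδ] with n hn
    refine (enorm_mollify_sub_sq_le hΩ.measurableSet (ρ n) u
      ((Metric.cthickening_mono hn.le _).trans hsub)).trans ?_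
    gcongr
    exact hD x hx y hy
  calc ∫⁻ x in A, ∫⁻ y in B, ‖val u x - val u y‖ₑ ^ 2
      ≤ ∫⁻ x in A, ∫⁻ y in B, Filter.liminf (fun n => D ^ 2 *
        segmentAverage (mollifyGradSq (ρ n) u) x y) Filter.atTop := by
        refine lintegral_mono_ae ?_
        filter_upwards [ae_restrict_of_ae hae, ae_restrict_mem hA] with x hxl hx
        refine lintegral_mono_ae ?_
        filter_upwards [ae_restrict_of_ae hae, ae_restrict_mem hB] with y hyl hy
        exact hpt x y hx hy hxl hyl
    _ ≤ Filter.liminf (fun n => ∫⁻ x in A, ∫⁻ y in B, D ^ 2 *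
        segmentAverage (mollifyGradSq (ρ n) u) x y) Filter.atTop :=
        lintegral_lintegral_liminf_le (fun n x y => D ^ 2 *
          segmentAverage (mollifyGradSq (ρ n) u) x y) fun n => measurable_const.mul (hm n)
    _ ≤ _ := by
        refine Filter.liminf_le_of_frequently_le' (Filter.Frequently.of_forall fun n => ?_)
        have h1 : ∀ x, ∫⁻ y in B, D ^ 2 * segmentAverage (mollifyGradSq (ρ n) u) x y =
            D ^ 2 * ∫⁻ y in B, segmentAverage (mollifyGradSq (ρ n) u) x y := fun x =>
          lintegral_const_mul _ (hmy n x)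
        simp_rw [h1]
        rw [lintegral_const_mul _ (Measurable.lintegral_prod_right' (hm n))]
        gcongr
        rw [← lintegral_mollifyGradSq hΩ.measurableSet (ρ n) u]
        exact lintegral_segments_le (hK n) A B

/-- On the subset `A` of `Ω`, Sobolev functions on `Ω` are close to constants when their gradient on
all of `Ω` is small. -/
def PoincareOn {d : ℕ} (Ω A : Set (E d)) : Prop :=
  ∃ C : ℝ≥0∞, C ≠ ⊤ ∧ ∀ u : H1 Ω, ∃ m : ℝ,
    ∫⁻ x in A, ‖val u x - m‖ₑ ^ 2 ≤ C * ∫⁻ x in Ω, ‖grad u x‖ₑ ^ 2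

theorem PoincareOn.of_segments {d : ℕ} {Ω A B : Set (E d)} (hΩ : IsOpen Ω)
    (hA : MeasurableSet A) (hB : MeasurableSet B) (hAb : Bornology.IsBounded A)
    (hBb : Bornology.IsBounded B) (hB0 : volume B ≠ 0)
    (hseg : ∀ x ∈ A, ∀ y ∈ B, segment ℝ x y ⊆ Ω) : PoincareOn Ω A := by
  have hAf : volume A ≠ ⊤ := hAb.measure_lt_top.ne
  have hBf : volume B ≠ ⊤ := hBb.measure_lt_top.ne
  have hDf : Metric.ediam (B ∪ A) ≠ ⊤ := (hBb.union hAb).ediam_ne_top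
  set D := Metric.ediam (B ∪ A)
  refine ⟨D ^ 2 * (volume B + volume A) * 2 ^ d / volume B, ?_, fun u => ?_⟩
  · refine ENNReal.div_ne_top ?_ hB0
    finiteness
  · have h1 := lintegral_lintegral_sub_sq_le hΩ u hB hA
      (fun x hx y hy => by rw [segment_symm]; exact hseg y hy x hx) (D := D) (fun x hx y hy => by
        rw [← edist_eq_enorm_sub]
        exact Metric.edist_le_ediam_of_mem (Or.inl hx) (Or.inr hy))
    have hum : Measurable (val u) := (Lp.stronglyMeasurable (val u)).measurable
    have hfm : Measurable fun y => ∫⁻ x in A, ‖val u y - val u x‖ₑ ^ 2 := by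
      apply Measurable.lintegral_prod_right'
        (f := fun q : E d × E d => ‖val u q.1 - val u q.2‖ₑ ^ 2)
      fun_prop
    obtain ⟨y, -, hy⟩ := exists_le_setLAverage hB0 hBf hfm.aemeasurable
    refine ⟨val u y, ?_⟩
    calc ∫⁻ x in A, ‖val u x - val u y‖ₑ ^ 2 = ∫⁻ x in A, ‖val u y - val u x‖ₑ ^ 2 := by
          simp_rw [enorm_sub_rev]
      _ ≤ _ := hy
      _ ≤ (D ^ 2 * ((volume B + volume A) * (2 ^ d * ∫⁻ x in Ω, ‖grad u x‖ₑ ^ 2))) / volume B := by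
          rw [setLAverage_eq]
          gcongr
      _ = _ := by
          simp only [div_eq_mul_inv]
          ring

theorem PoincareOn.mono {d : ℕ} {Ω A B : Set (E d)} (h : PoincareOn Ω B) (hAB : A ⊆ B) :
    PoincareOn Ω A := by
  obtain ⟨C, hC, hu⟩ := h
  refine ⟨C, hC, fun u => ?_⟩
  obtain ⟨m, hm⟩ := hu u
  exact ⟨m, (lintegral_mono_set hAB).trans hm⟩

theorem enorm_sub_sq_le (a b c : ℝ) : ‖a - c‖ₑ ^ 2 ≤ 2 * (‖a - b‖ₑ ^ 2 + ‖b - c‖ₑ ^ 2) := by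
  have h : ‖a - c‖ₑ ≤ ‖a - b‖ₑ + ‖b - c‖ₑ := by
    have := enorm_add_le (a - b) (b - c)
    simpa using this
  calc ‖a - c‖ₑ ^ 2 ≤ (‖a - b‖ₑ + ‖b - c‖ₑ) ^ 2 := by gcongr
    _ ≤ _ := by
      have := ENNReal.rpow_add_le_mul_rpow_add_rpow ‖a - b‖ₑ ‖b - c‖ₑ (p := 2) (by norm_num)
      norm_num at this
      exact_mod_cast this

/-- The constants belonging to two overlapping sets are close, because both are close to the
function on the intersection. -/
theorem PoincareOn.union {d : ℕ} {Ω A B : Set (E d)} (hA : PoincareOn Ω A) (hB : PoincareOn Ω B)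
    (hBf : volume B ≠ ⊤) (hAB : volume (A ∩ B) ≠ 0) :
    PoincareOn Ω (A ∪ B) := by
  obtain ⟨C, hC, hu⟩ := hA
  obtain ⟨C', hC', hu'⟩ := hB
  have hABf : volume (A ∩ B) ≠ ⊤ := measure_ne_top_of_subset inter_subset_right hBf
  refine ⟨C + 2 * (C' + 2 * (C + C') / volume (A ∩ B) * volume B), ?_, fun u => ?_⟩
  · have : 2 * (C + C') / volume (A ∩ B) ≠ ⊤ := ENNReal.div_ne_top (by finiteness) hAB
    finiteness
  · obtain ⟨m, hm⟩ := hu u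
    obtain ⟨m', hm'⟩ := hu' u
    set G := ∫⁻ x in Ω, ‖grad u x‖ₑ ^ 2
    have hum : Measurable (val u) := (Lp.stronglyMeasurable (val u)).measurable
    have h1 : ‖m' - m‖ₑ ^ 2 ≤ 2 * (C + C') / volume (A ∩ B) * G := by
      have h2 : ‖m' - m‖ₑ ^ 2 * volume (A ∩ B) ≤ 2 * (C + C') * G := by
        rw [← setLIntegral_const]
        calc ∫⁻ x in A ∩ B, ‖m' - m‖ₑ ^ 2
            ≤ ∫⁻ x in A ∩ B, 2 * (‖val u x - m'‖ₑ ^ 2 + ‖val u x - m‖ₑ ^ 2) := by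
              refine lintegral_mono fun x => ?_
              rw [enorm_sub_rev (val u x) m']
              exact enorm_sub_sq_le _ _ _
          _ = 2 * ((∫⁻ x in A ∩ B, ‖val u x - m'‖ₑ ^ 2) + ∫⁻ x in A ∩ B, ‖val u x - m‖ₑ ^ 2) := by
              rw [lintegral_const_mul _ (by fun_prop), lintegral_add_left (by fun_prop)]
          _ ≤ 2 * (C' * G + C * G) := by
              gcongr
              · exact (lintegral_mono_set inter_subset_right).trans hm'
              · exact (lintegral_mono_set inter_subset_left).trans hm
          _ = _ := by ring
      rw [← ENNReal.mul_div_right_comm, ENNReal.le_div_iff_mul_le (Or.inl hAB) (Or.inl hABf)]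
      exact h2
    refine ⟨m, ?_⟩
    calc ∫⁻ x in A ∪ B, ‖val u x - m‖ₑ ^ 2
        ≤ (∫⁻ x in A, ‖val u x - m‖ₑ ^ 2) + ∫⁻ x in B, ‖val u x - m‖ₑ ^ 2 :=
          lintegral_union_le _ _ _
      _ ≤ C * G + ∫⁻ x in B, 2 * (‖val u x - m'‖ₑ ^ 2 + ‖m' - m‖ₑ ^ 2) := by
          gcongr
          exact enorm_sub_sq_le _ _ _
      _ = C * G + 2 * ((∫⁻ x in B, ‖val u x - m'‖ₑ ^ 2) + ‖m' - m‖ₑ ^ 2 * volume B) := by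
          rw [lintegral_const_mul _ (by fun_prop), lintegral_add_left (by fun_prop),
            setLIntegral_const]
      _ ≤ C * G + 2 * (C' * G + (2 * (C + C') / volume (A ∩ B) * G) * volume B) := by
          gcongr
      _ = _ := by ring

/-- Near a boundary point at which `Ω` is the region above the graph of a locally Lipschitz
function, the points of `Ω` see a small ball lying vertically above the boundary point. -/
theorem HasC11Boundary.exists_poincareOn {d : ℕ} {Ω : Set (E d)} (hΩ : IsOpen Ω)
    (h : HasC11Boundary Ω) {x₀ : E d} (hx₀ : x₀ ∈ frontier Ω) :
    ∃ W : Set (E d), IsOpen W ∧ x₀ ∈ W ∧ PoincareOn Ω (W ∩ Ω) := by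
  obtain ⟨U, ν, γ, K, hU, hxU, hν, hγ, hK, hgraph⟩ := h x₀ hx₀
  obtain ⟨R, hR, hRU⟩ := Metric.isOpen_iff.1 hU x₀ hxU
  have hproj : ∀ x : E d, ‖x - ⟪ν, x⟫ • ν‖ ≤ 2 * ‖x‖ := by
    intro x
    have h1 : |⟪ν, x⟫| ≤ ‖x‖ := by simpa [hν] using abs_real_inner_le_norm ν x
    calc ‖x - ⟪ν, x⟫ • ν‖ ≤ ‖x‖ + ‖⟪ν, x⟫ • ν‖ := norm_sub_le _ _
      _ ≤ ‖x‖ + ‖x‖ := by rw [norm_smul, hν, mul_one, Real.norm_eq_abs]; gcongr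
      _ = _ := by ring
  set π : E d → E d := fun x => x - ⟪ν, x⟫ • ν with hπ
  have hπsub : ∀ x y, π x - π y = π (x - y) := by
    intro x y
    simp only [hπ, inner_sub_right, sub_smul]
    abel
  set L : ℝ := ‖fderiv ℝ γ (π x₀)‖ + K * (2 * R) with hL
  have hL0 : 0 ≤ L := by positivity
  have hLip : ∀ x ∈ Metric.ball x₀ R, ∀ y ∈ Metric.ball x₀ R,
      γ (π y) - γ (π x) ≤ L * ‖π y - π x‖ := by
    intro x hx y hy
    have hb : ∀ z ∈ Metric.ball x₀ R, π z ∈ Metric.ball (π x₀) (2 * R) := by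
      intro z hz
      rw [Metric.mem_ball, dist_eq_norm] at hz ⊢
      rw [hπsub]
      linarith [hproj (z - x₀)]
    refine (le_abs_self _).trans ((convex_ball (π x₀) (2 * R)).norm_image_sub_le_of_norm_fderiv_le
      (fun z _ => hγ z) (fun z hz => ?_) (hb x hx) (hb y hy))
    have h1 := hK.dist_le_mul z (π x₀)
    rw [dist_eq_norm, dist_eq_norm] at h1
    rw [Metric.mem_ball, dist_eq_norm] at hz
    have h2 : ‖fderiv ℝ γ z‖ ≤ ‖fderiv ℝ γ (π x₀)‖ + ‖fderiv ℝ γ z - fderiv ℝ γ (π x₀)‖ := by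
      have := norm_add_le (fderiv ℝ γ (π x₀)) (fderiv ℝ γ z - fderiv ℝ γ (π x₀))
      simpa using this
    have h3 : (K : ℝ) * ‖z - π x₀‖ ≤ K * (2 * R) := by gcongr
    linarith
  -- The slope of the segments to the small ball exceeds `L` if `(4 * L + 2) * ε < R / 2`.
  set ε : ℝ := R / (16 * (L + 1)) with hε
  have hε0 : 0 < ε := by positivity
  have hεR : ε * (16 * (L + 1)) = R := by rw [hε]; field_simp
  have hε1 : ε ≤ R / 16 := by nlinarith [mul_nonneg hε0.le hL0]
  set p : E d := x₀ + (R / 2) • ν with hp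
  have hpx : p - x₀ = (R / 2) • ν := by rw [hp]; abel
  have hsee : ∀ x ∈ Metric.ball x₀ ε ∩ Ω, ∀ y ∈ Metric.ball p ε, segment ℝ x y ⊆ Ω := by
    rintro x ⟨hx, hxΩ⟩ y hy z hz
    rw [Metric.mem_ball, dist_eq_norm] at hx hy
    have hxR : x ∈ Metric.ball x₀ R := by
      rw [Metric.mem_ball, dist_eq_norm]; linarith
    have hyR : y ∈ Metric.ball x₀ R := by
      rw [Metric.mem_ball, dist_eq_norm]
      calc ‖y - x₀‖ = ‖(y - p) + (p - x₀)‖ := by congr 1; abel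
        _ ≤ ‖y - p‖ + ‖p - x₀‖ := norm_add_le _ _
        _ < R := by
          rw [hpx, norm_smul, hν, Real.norm_of_nonneg (by positivity)]
          linarith
    have hzR : z ∈ Metric.ball x₀ R := (convex_ball x₀ R).segment_subset hxR hyR hz
    obtain ⟨t, ⟨ht0, ht1⟩, rfl⟩ := (segment_eq_image' ℝ x y) ▸ hz
    set e : E d := (y - p) - (x - x₀) with he
    have hen : ‖e‖ ≤ 2 * ε := (norm_sub_le _ _).trans (by linarith)
    have hyx : y - x = (R / 2) • ν + e := by rw [he, ← hpx]; abel
    have hνν : ⟪ν, ν⟫ = (1 : ℝ) := by rw [real_inner_self_eq_norm_sq, hν]; norm_num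
    have h1 : π (x + t • (y - x)) - π x = t • π e := by
      rw [hπsub, add_sub_cancel_left, hyx]
      simp only [hπ, inner_add_right, inner_smul_right, hνν]
      module
    have h2 := hLip x hxR _ hzR
    have hγx := (hgraph x (hRU hxR)).1 hxΩ
    refine (hgraph _ (hRU hzR)).2 ?_
    change γ (π (x + t • (y - x))) < ⟪ν, x + t • (y - x)⟫
    change γ (π x) < ⟪ν, x⟫ at hγx
    rw [h1, norm_smul, Real.norm_of_nonneg ht0] at h2
    have h3 : L * (t * ‖π e‖) ≤ t * (L * (4 * ε)) := by
      have : ‖π e‖ ≤ 4 * ε := (hproj e).trans (by linarith)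
      calc L * (t * ‖π e‖) ≤ L * (t * (4 * ε)) := by gcongr
        _ = _ := by ring
    have h4 : ⟪ν, x + t • (y - x)⟫ = ⟪ν, x⟫ + t * (R / 2 + ⟪ν, e⟫) := by
      rw [hyx]
      simp only [inner_add_right, inner_smul_right, hνν]
      ring
    have h5 : -(2 * ε) ≤ ⟪ν, e⟫ := by
      have : |⟪ν, e⟫| ≤ ‖e‖ := by simpa [hν] using abs_real_inner_le_norm ν e
      linarith [(abs_le.1 this).1]
    have h6 : t * (L * (4 * ε)) ≤ t * (R / 2 + ⟪ν, e⟫) := by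
      gcongr
      nlinarith [mul_nonneg hε0.le hL0]
    linarith
  exact ⟨Metric.ball x₀ ε, Metric.isOpen_ball, Metric.mem_ball_self hε0,
    PoincareOn.of_segments hΩ (measurableSet_ball.inter hΩ.measurableSet) measurableSet_ball
      (Metric.isBounded_ball.subset inter_subset_left) Metric.isBounded_ball
      (Metric.measure_ball_pos volume p hε0).ne' hsee⟩

theorem exists_poincareOn_of_mem {d : ℕ} {Ω : Set (E d)} (hΩ : IsOpen Ω) {x₀ : E d}
    (hx₀ : x₀ ∈ Ω) : ∃ W : Set (E d), IsOpen W ∧ x₀ ∈ W ∧ PoincareOn Ω (W ∩ Ω) := by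
  obtain ⟨r, hr, hsub⟩ := Metric.isOpen_iff.1 hΩ x₀ hx₀
  refine ⟨Metric.ball x₀ r, Metric.isOpen_ball, Metric.mem_ball_self hr, ?_⟩
  exact (PoincareOn.of_segments hΩ measurableSet_ball measurableSet_ball Metric.isBounded_ball
    Metric.isBounded_ball (Metric.measure_ball_pos volume x₀ hr).ne' fun x hx y hy =>
      ((convex_ball x₀ r).segment_subset hx hy).trans hsub).mono inter_subset_left

theorem IsAdmissibleDomain.exists_poincareOn {d : ℕ} {Ω : Set (E d)} (hΩ : IsAdmissibleDomain Ω)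
    {x₀ : E d} (hx₀ : x₀ ∈ closure Ω) :
    ∃ W : Set (E d), IsOpen W ∧ x₀ ∈ W ∧ PoincareOn Ω (W ∩ Ω) := by
  by_cases hmem : x₀ ∈ Ω
  · exact exists_poincareOn_of_mem hΩ.isOpen hmem
  rcases hΩ.boundary with h | ⟨V, hV⟩
  · exact h.exists_poincareOn hΩ.isOpen (by rw [hΩ.isOpen.frontier_eq]; exact ⟨hx₀, hmem⟩)
  · have hconv : Convex ℝ Ω := hV ▸ (convex_convexHull ℝ _).interior
    exact ⟨univ, isOpen_univ, mem_univ _, (PoincareOn.of_segments hΩ.isOpen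
      hΩ.isOpen.measurableSet hΩ.isOpen.measurableSet hΩ.isBounded hΩ.isBounded
      (hΩ.isOpen.measure_pos volume hΩ.isConnected.nonempty).ne'
      fun x hx y hy => hconv.segment_subset hx hy).mono inter_subset_right⟩

/-- Poincaré's inequality: the local inequalities are chained together by means of the
connectedness of `Ω` and the compactness of its closure. -/
theorem IsAdmissibleDomain.poincareOn {d : ℕ} {Ω : Set (E d)} (hΩ : IsAdmissibleDomain Ω) :
    PoincareOn Ω Ω := by
  have hunion : ∀ {A B : Set (E d)}, IsOpen A → IsOpen B → B ⊆ Ω → (A ∩ B).Nonempty →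
      PoincareOn Ω A → PoincareOn Ω B → PoincareOn Ω (A ∪ B) := by
    intro A B hA hB hBΩ hne hPA hPB
    exact hPA.union hPB (hΩ.isBounded.subset hBΩ).measure_lt_top.ne
      ((hA.inter hB).measure_pos volume hne).ne'
  have hjoin : ∀ {x y : E d}, x ∈ Ω → y ∈ Ω →
      ∃ A : Set (E d), IsOpen A ∧ A ⊆ Ω ∧ x ∈ A ∧ y ∈ A ∧ PoincareOn Ω A := by
    intro x y hx hy
    refine hΩ.isConnected.isPreconnected.induction₂
      (fun x y => ∃ A : Set (E d), IsOpen A ∧ A ⊆ Ω ∧ x ∈ A ∧ y ∈ A ∧ PoincareOn Ω A)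
      ?_ ?_ ?_ hx hy
    · intro z hz
      obtain ⟨W, hW, hzW, hP⟩ := exists_poincareOn_of_mem hΩ.isOpen hz
      filter_upwards [mem_nhdsWithin_of_mem_nhds (hW.mem_nhds hzW), self_mem_nhdsWithin]
        with a ha haΩ
      exact ⟨W ∩ Ω, hW.inter hΩ.isOpen, inter_subset_right, ⟨hzW, hz⟩, ⟨ha, haΩ⟩, hP⟩
    · rintro a b c - - - ⟨A, hA, hAΩ, haA, hbA, hPA⟩ ⟨B, hB, hBΩ, hbB, hcB, hPB⟩
      exact ⟨A ∪ B, hA.union hB, union_subset hAΩ hBΩ, Or.inl haA, Or.inr hcB,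
        hunion hA hB hBΩ ⟨b, hbA, hbB⟩ hPA hPB⟩
    · rintro a b - - ⟨A, hA, hAΩ, haA, hbA, hPA⟩
      exact ⟨A, hA, hAΩ, hbA, haA, hPA⟩
  obtain ⟨x₁, hx₁⟩ := hΩ.isConnected.nonempty
  have hcover := hΩ.isBounded.isCompact_closure.induction_on
    (p := fun S => ∃ A : Set (E d), IsOpen A ∧ A ⊆ Ω ∧ x₁ ∈ A ∧ S ∩ Ω ⊆ A ∧ PoincareOn Ω A)
    ?_ ?_ ?_ ?_
  · obtain ⟨A, -, -, -, hA, hP⟩ := hcover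
    exact hP.mono fun x hx => hA ⟨subset_closure hx, hx⟩
  · obtain ⟨A, hA, hAΩ, hxA, -, hP⟩ := hjoin hx₁ hx₁
    exact ⟨A, hA, hAΩ, hxA, by simp, hP⟩
  · rintro S T hST ⟨A, hA, hAΩ, hxA, hTA, hP⟩
    exact ⟨A, hA, hAΩ, hxA, (inter_subset_inter_left _ hST).trans hTA, hP⟩
  · rintro S T ⟨A, hA, hAΩ, hxA, hSA, hPA⟩ ⟨B, hB, hBΩ, hxB, hTB, hPB⟩
    refine ⟨A ∪ B, hA.union hB, union_subset hAΩ hBΩ, Or.inl hxA, ?_,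
      hunion hA hB hBΩ ⟨x₁, hxA, hxB⟩ hPA hPB⟩
    rw [union_inter_distrib_right]
    exact union_subset_union hSA hTB
  · intro x hx
    obtain ⟨W, hW, hxW, hP⟩ := hΩ.exists_poincareOn hx
    obtain ⟨y, hyW, hyΩ⟩ := mem_closure_iff.1 hx W hW hxW
    obtain ⟨A, hA, hAΩ, hxA, hyA, hPA⟩ := hjoin hx₁ hyΩ
    refine ⟨W, mem_nhdsWithin_of_mem_nhds (hW.mem_nhds hxW), A ∪ (W ∩ Ω),
      hA.union (hW.inter hΩ.isOpen), union_subset hAΩ inter_subset_right, Or.inl hxA,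
      subset_union_right, hunion hA (hW.inter hΩ.isOpen) inter_subset_right
        ⟨y, hyA, hyW, hyΩ⟩ hPA hP⟩

/-! ### The Hilbert space `H¹(Ω)` -/

theorem inner_eq_mul_real (a b : ℝ) : ⟪a, b⟫ = a * b := by simp [mul_comm]

/-- The embedding of `H¹(Ω)` into `L²(Ω)`. -/
def valL {d : ℕ} (Ω : Set (E d)) : H1 Ω →L[ℝ] L2 Ω :=
  (WithLp.fstL 2 ℝ (L2 Ω) (Lp (E d) 2 (vol Ω))).comp (H1 Ω).subtypeL

/-- The weak gradient as a bounded operator. -/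
def gradL {d : ℕ} (Ω : Set (E d)) : H1 Ω →L[ℝ] Lp (E d) 2 (vol Ω) :=
  (WithLp.sndL 2 ℝ (L2 Ω) (Lp (E d) 2 (vol Ω))).comp (H1 Ω).subtypeL

@[simp]
theorem valL_apply {d : ℕ} {Ω : Set (E d)} (u : H1 Ω) : valL Ω u = val u := rfl

@[simp]
theorem gradL_apply {d : ℕ} {Ω : Set (E d)} (u : H1 Ω) : gradL Ω u = grad u := rfl

theorem norm_sq_H1 {d : ℕ} {Ω : Set (E d)} (u : H1 Ω) :
    ‖u‖ ^ 2 = ‖val u‖ ^ 2 + ‖grad u‖ ^ 2 :=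
  WithLp.prod_norm_sq_eq_of_L2 (u : WithLp 2 (L2 Ω × Lp (E d) 2 (vol Ω)))

theorem IsTest.memLp_smul {d : ℕ} {Ω : Set (E d)} {ψ : E d → ℝ} (h : IsTest Ω ψ) (v : E d) :
    MemLp (fun x => ψ x • v) 2 (vol Ω) :=
  ((h.1.continuous.smul continuous_const).memLp_of_hasCompactSupport h.2.1.smul_right).restrict Ω

/-- `H¹(Ω)` is complete, since the identity defining the weak gradient passes to limits in `L²`. -/
theorem completeSpace_H1 {d : ℕ} (Ω : Set (E d)) : CompleteSpace (H1 Ω) := by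
  have hclosed : IsClosed (H1 Ω : Set (WithLp 2 (L2 Ω × Lp (E d) 2 (vol Ω)))) := by
    have heq : (H1 Ω : Set (WithLp 2 (L2 Ω × Lp (E d) 2 (vol Ω)))) =
        ⋂ (ψ : E d → ℝ) (hψ : IsTest Ω ψ) (v : E d),
          {p | ⟪p.fst, (hψ.memLp_fderiv v).toLp⟫ = - ⟪p.snd, (hψ.memLp_smul v).toLp⟫} := by
      ext p
      simp only [mem_iInter, SetLike.mem_coe, mem_ofPred_eq]
      refine forall_congr' fun ψ => forall_congr' fun hψ => forall_congr' fun v => ?_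
      have h1 : ⟪p.fst, (hψ.memLp_fderiv v).toLp⟫ = ∫ x in Ω, p.fst x * fderiv ℝ ψ x v := by
        rw [L2.inner_def]
        refine integral_congr_ae ?_
        filter_upwards [(hψ.memLp_fderiv v).coeFn_toLp] with x hx
        rw [hx, inner_eq_mul_real]
      have h2 : ⟪p.snd, (hψ.memLp_smul v).toLp⟫ = ∫ x in Ω, ⟪p.snd x, v⟫ * ψ x := by
        rw [L2.inner_def]
        refine integral_congr_ae ?_
        filter_upwards [(hψ.memLp_smul v).coeFn_toLp] with x hx
        rw [hx, inner_smul_right, mul_comm]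
      rw [h1, h2]
    rw [heq]
    refine isClosed_iInter fun ψ => isClosed_iInter fun hψ => isClosed_iInter fun v => ?_
    exact isClosed_eq ((WithLp.continuous_fst 2 _ _).inner continuous_const)
      ((WithLp.continuous_snd 2 _ _).inner continuous_const).neg
  exact hclosed.completeSpace_coe

theorem memLp_of_continuous {d : ℕ} {Ω : Set (E d)} (hΩb : Bornology.IsBounded Ω)
    {F : Type*} [NormedAddCommGroup F] {f : E d → F} [SecondCountableTopologyEither (E d) F]
    (hf : Continuous f) (p : ℝ≥0∞) : MemLp f p (vol Ω) := by
  have : IsFiniteMeasure (vol Ω) := ⟨by simpa using hΩb.measure_lt_top⟩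
  obtain ⟨C, hC⟩ := hΩb.isCompact_closure.exists_bound_of_continuousOn hf.continuousOn
  refine MemLp.of_bound hf.aestronglyMeasurable C ?_
  exact (ae_restrict_mem (measurableSet_closure (s := Ω))).filter_mono
    (ae_mono (Measure.restrict_mono subset_closure le_rfl)) |>.mono fun x hx => hC x hx

/-- A continuously differentiable function is a Sobolev function on bounded sets, and its weak
gradient is the classical one. -/
theorem exists_H1_of_contDiff {d : ℕ} {Ω : Set (E d)} (hΩb : Bornology.IsBounded Ω)
    {f : E d → ℝ} {G : E d → E d} (hf : ContDiff ℝ 1 f)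
    (hG : Continuous G) (hfG : ∀ x v, fderiv ℝ f x v = ⟪G x, v⟫) :
    ∃ u : H1 Ω, val u =ᵐ[vol Ω] f ∧ grad u =ᵐ[vol Ω] G := by
  have h1 : MemLp f 2 (vol Ω) := memLp_of_continuous hΩb hf.continuous 2
  have h2 : MemLp G 2 (vol Ω) := memLp_of_continuous hΩb hG 2
  refine ⟨⟨WithLp.toLp 2 (h1.toLp, h2.toLp), ?_⟩, h1.coeFn_toLp, h2.coeFn_toLp⟩
  intro ψ hψ v
  have hψd : Continuous fun x => fderiv ℝ ψ x v :=
    (hψ.1.continuous_fderiv (by simp)).clm_apply continuous_const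
  have e1 : ∫ x in Ω, h1.toLp f x * fderiv ℝ ψ x v = ∫ x, f x * fderiv ℝ ψ x v := by
    rw [← setIntegral_eq_integral_of_forall_compl_eq_zero (s := Ω) (μ := volume)
      (f := fun x => f x * fderiv ℝ ψ x v)]
    · refine integral_congr_ae ?_
      filter_upwards [h1.coeFn_toLp] with x hx
      rw [hx]
    · intro x hx
      have : x ∉ tsupport (fderiv ℝ ψ) := fun h => hx (hψ.2.2 (tsupport_fderiv_subset ℝ h))
      simp [image_eq_zero_of_notMem_tsupport this]
  have e2 : ∫ x in Ω, ⟪h2.toLp G x, v⟫ * ψ x = ∫ x, fderiv ℝ f x v * ψ x := by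
    rw [← setIntegral_eq_integral_of_forall_compl_eq_zero (s := Ω) (μ := volume)
      (f := fun x => fderiv ℝ f x v * ψ x)]
    · refine integral_congr_ae ?_
      filter_upwards [h2.coeFn_toLp] with x hx
      rw [hx, hfG]
    · intro x hx
      have : x ∉ tsupport ψ := fun h => hx (hψ.2.2 h)
      rw [image_eq_zero_of_notMem_tsupport this, mul_zero]
  change ∫ x in Ω, h1.toLp f x * fderiv ℝ ψ x v = - ∫ x in Ω, ⟪h2.toLp G x, v⟫ * ψ x
  rw [e1, e2]
  have hfd : Continuous fun x => fderiv ℝ f x v :=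
    (hf.continuous_fderiv (by simp)).clm_apply continuous_const
  refine integral_mul_fderiv_eq_neg_fderiv_mul_of_integrable ?_ ?_ ?_
    (fun x _ => hf.differentiable (by simp) x) (fun x _ => hψ.1.differentiable (by simp) x)
  · exact (hfd.mul hψ.1.continuous).integrable_of_hasCompactSupport hψ.2.1.mul_left
  · exact (hf.continuous.mul hψd).integrable_of_hasCompactSupport
      (hψ.2.1.fderiv_apply ℝ v).mul_left
  · exact (hf.continuous.mul hψ.1.continuous).integrable_of_hasCompactSupport hψ.2.1.mul_left

theorem form_const {d : ℕ} {Ω : Set (E d)} (α lam : ℝ) (u w : H1 Ω) :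
    form Ω (fun _ => α) (fun _ => 0) lam u w = α * ⟪grad u, grad w⟫ - lam * ⟪val u, val w⟫ := by
  rw [L2.inner_def, L2.inner_def, ← integral_const_mul, ← integral_const_mul,
    ← integral_sub ((L2.integrable_inner _ _).const_mul _) ((L2.integrable_inner _ _).const_mul _)]
  refine integral_congr_ae (Filter.Eventually.of_forall fun x => ?_)
  simp only [inner_eq_mul_real]
  ring

theorem form_const_comm {d : ℕ} {Ω : Set (E d)} (α lam : ℝ) (u w : H1 Ω) :
    form Ω (fun _ => α) (fun _ => 0) lam u w = form Ω (fun _ => α) (fun _ => 0) lam w u := by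
  rw [form_const, form_const, real_inner_comm, real_inner_comm (val u)]

/-- The weak form with constant diffusion and without absorption as a bounded bilinear form. -/
def formL {d : ℕ} (Ω : Set (E d)) (α lam : ℝ) : H1 Ω →L[ℝ] H1 Ω →L[ℝ] ℝ :=
  α • (innerSL ℝ).bilinearComp (gradL Ω) (gradL Ω) -
    lam • (innerSL ℝ).bilinearComp (valL Ω) (valL Ω)

theorem formL_apply {d : ℕ} {Ω : Set (E d)} (α lam : ℝ) (u w : H1 Ω) :
    formL Ω α lam u w = form Ω (fun _ => α) (fun _ => 0) lam u w := by
  rw [form_const]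
  rfl

theorem enorm_sq_eq_lintegral {d : ℕ} {Ω : Set (E d)} {F : Type*} [NormedAddCommGroup F]
    (f : Lp F 2 (vol Ω)) : ‖f‖ₑ ^ 2 = ∫⁻ x in Ω, ‖f x‖ₑ ^ 2 := by
  rw [Lp.enorm_def, eLpNorm_eq_lintegral_rpow_enorm_toReal (by norm_num) (by norm_num),
    ← ENNReal.rpow_natCast, ← ENNReal.rpow_mul]
  norm_num

/-- Poincaré's inequality as an inequality between norms; `e` is the constant function `1`. -/
theorem IsAdmissibleDomain.exists_norm_sub_sq_le {d : ℕ} {Ω : Set (E d)}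
    (hΩ : IsAdmissibleDomain Ω) {e : H1 Ω} (he : val e =ᵐ[vol Ω] fun _ => 1) :
    ∃ C : ℝ, 0 < C ∧ ∀ u : H1 Ω, ∃ m : ℝ, ‖val u - m • val e‖ ^ 2 ≤ C * ‖grad u‖ ^ 2 := by
  obtain ⟨C, hC, h⟩ := hΩ.poincareOn
  refine ⟨C.toReal + 1, by positivity, fun u => ?_⟩
  obtain ⟨m, hm⟩ := h u
  refine ⟨m, ?_⟩
  have h1 : ‖val u - m • val e‖ₑ ^ 2 = ∫⁻ x in Ω, ‖val u x - m‖ₑ ^ 2 := by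
    rw [enorm_sq_eq_lintegral]
    refine lintegral_congr_ae ?_
    filter_upwards [Lp.coeFn_sub (val u) (m • val e), Lp.coeFn_smul m (val e), he] with x h1 h2 h3
    rw [h1, Pi.sub_apply, h2, Pi.smul_apply, h3, smul_eq_mul, mul_one]
  rw [← h1, ← enorm_sq_eq_lintegral] at hm
  have h2 := ENNReal.toReal_mono (by finiteness) hm
  simp only [ENNReal.toReal_pow, ENNReal.toReal_mul, toReal_enorm] at h2
  nlinarith [sq_nonneg ‖grad u‖]

/-- A bounded bilinear form that becomes coercive after composition with an involution in its second
argument induces an isomorphism. -/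
theorem existsUnique_of_isCoercive_comp {V : Type*} [NormedAddCommGroup V] [InnerProductSpace ℝ V]
    [CompleteSpace V] {b : V →L[ℝ] V →L[ℝ] ℝ} {S : V →L[ℝ] V} (hS : ∀ u, S (S u) = u)
    (hb : IsCoercive (b.bilinearComp (ContinuousLinearMap.id ℝ V) S)) (ℓ : V →L[ℝ] ℝ) :
    ∃! u, ∀ w, b u w = ℓ w := by
  have hiff : ∀ u, (∀ w, b u w = ℓ w) ↔
      ∀ w, b.bilinearComp (ContinuousLinearMap.id ℝ V) S u w = ℓ (S w) := by
    refine fun u => ⟨fun h w => h _, fun h w => ?_⟩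
    rw [← hS w, ← h]
    rfl
  simp_rw [hiff]
  set f := (InnerProductSpace.toDual ℝ V).symm (ℓ.comp S) with hf
  have hfS : ∀ w, ⟪f, w⟫ = ℓ (S w) := fun w => by
    rw [hf, InnerProductSpace.toDual_symm_apply]
    rfl
  refine ⟨hb.continuousLinearEquivOfBilin.symm f, fun w => ?_, fun u hu => ?_⟩
  · rw [← hb.continuousLinearEquivOfBilin_apply, ContinuousLinearEquiv.apply_symm_apply, hfS]
  · rw [hb.unique_continuousLinearEquivOfBilin (v := u) (f := f) fun w => by rw [hfS, hu],
      ContinuousLinearEquiv.symm_apply_apply]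

theorem min_mul_le_of_le_mul {α C lam P M G : ℝ} (hα : 0 < α) (hC : 0 < C) (hlam : 0 < lam)
    (hlamC : lam * (2 * C) < α) (hM : 0 ≤ M) (hG : 0 ≤ G) (hPG : P ≤ C * G) :
    min (α / 4) (min (α / (4 * C)) lam) * (P + M + G) ≤ α * G - lam * (P - M) := by
  set c := min (α / 4) (min (α / (4 * C)) lam)
  have hc1 : c ≤ α / 4 := min_le_left _ _
  have hc2 : c ≤ α / (4 * C) := (min_le_right _ _).trans (min_le_left _ _)
  have hc3 : c ≤ lam := (min_le_right _ _).trans (min_le_right _ _)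
  rw [le_div_iff₀ (by positivity)] at hc2
  have hc0 : 0 < c := by positivity
  have t1 : c * G ≤ α / 4 * G := by gcongr
  have t2 : c * M ≤ lam * M := by gcongr
  have t3 : c * P ≤ α / 4 * G := by
    calc c * P ≤ c * (C * G) := by gcongr
      _ = (c * (4 * C)) / 4 * G := by ring
      _ ≤ _ := by gcongr
  have t4 : lam * P ≤ α / 2 * G := by
    calc lam * P ≤ lam * (C * G) := by gcongr
      _ = (lam * (2 * C)) / 2 * G := by ring
      _ ≤ _ := by gcongr
  linarith

/-- The mean value as a functional on `H¹(Ω)`, where `e` is the constant function `1`. -/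
def meanL {d : ℕ} {Ω : Set (E d)} (e : H1 Ω) : H1 Ω →L[ℝ] ℝ :=
  (‖val e‖ ^ 2)⁻¹ • (innerSL ℝ (val e)).comp (valL Ω)

/-- The reflection of `H¹(Ω)` that changes the sign of the mean value. -/
def reflectMean {d : ℕ} {Ω : Set (E d)} (e : H1 Ω) : H1 Ω →L[ℝ] H1 Ω :=
  ContinuousLinearMap.id ℝ _ - (2 : ℝ) • (meanL e).smulRight e

theorem meanL_apply {d : ℕ} {Ω : Set (E d)} (e u : H1 Ω) :
    meanL e u = (‖val e‖ ^ 2)⁻¹ * ⟪val e, val u⟫ := rfl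

theorem reflectMean_apply {d : ℕ} {Ω : Set (E d)} (e u : H1 Ω) :
    reflectMean e u = u - (2 * meanL e u) • e := by
  simp [reflectMean, smul_smul]

theorem inner_val_eq_meanL_mul {d : ℕ} {Ω : Set (E d)} {e : H1 Ω} (he : val e ≠ 0) (u : H1 Ω) :
    ⟪val u, val e⟫ = meanL e u * ‖val e‖ ^ 2 := by
  rw [meanL_apply, real_inner_comm]
  field_simp

theorem reflectMean_reflectMean {d : ℕ} {Ω : Set (E d)} {e : H1 Ω} (he : val e ≠ 0) (u : H1 Ω) :
    reflectMean e (reflectMean e u) = u := by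
  have h : meanL e e = 1 := by
    rw [meanL_apply, real_inner_self_eq_norm_sq]
    field_simp
  rw [reflectMean_apply e (reflectMean e u), reflectMean_apply e u, map_sub, map_smul, h,
    smul_eq_mul, mul_one]
  module

theorem val_reflectMean {d : ℕ} {Ω : Set (E d)} (e u : H1 Ω) :
    val (reflectMean e u) = val u - (2 * meanL e u) • val e := by
  rw [reflectMean_apply, ← valL_apply, map_sub, map_smul]
  rfl

theorem grad_reflectMean {d : ℕ} {Ω : Set (E d)} {e : H1 Ω} (he : grad e = 0) (u : H1 Ω) :
    grad (reflectMean e u) = grad u := by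
  rw [reflectMean_apply, ← gradL_apply, map_sub, map_smul, gradL_apply, gradL_apply, he, smul_zero,
    sub_zero]

/-- The weak form is negative on constants and positive on functions of mean value zero, so that it
becomes coercive when the sign of the mean value is changed in one argument. -/
theorem isCoercive_formL_reflectMean {d : ℕ} {Ω : Set (E d)} {e : H1 Ω} (he : val e ≠ 0)
    (hge : grad e = 0) {C : ℝ} (hC : 0 < C)
    (hP : ∀ u : H1 Ω, ∃ m : ℝ, ‖val u - m • val e‖ ^ 2 ≤ C * ‖grad u‖ ^ 2) {α lam : ℝ}
    (hα : 0 < α) (hlam : 0 < lam) (hlamC : lam * (2 * C) < α) :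
    IsCoercive ((formL Ω α lam).bilinearComp (ContinuousLinearMap.id ℝ _) (reflectMean e)) := by
  refine ⟨min (α / 4) (min (α / (4 * C)) lam), by positivity, fun u => ?_⟩
  rw [ContinuousLinearMap.bilinearComp_apply, ContinuousLinearMap.id_apply, formL_apply,
    form_const, grad_reflectMean hge, val_reflectMean, inner_sub_right, inner_smul_right,
    inner_val_eq_meanL_mul he, real_inner_self_eq_norm_sq, real_inner_self_eq_norm_sq]
  set m := meanL e u with hm
  set N := ‖val e‖ ^ 2 with hN
  set P := ‖val u‖ ^ 2 - m ^ 2 * N with hPdef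
  have hN0 : 0 < N := by positivity
  have hsq : ∀ r : ℝ, ‖val u - r • val e‖ ^ 2 = P + (r - m) ^ 2 * N := by
    intro r
    rw [norm_sub_sq_real, inner_smul_right, inner_val_eq_meanL_mul he, norm_smul, mul_pow,
      Real.norm_eq_abs, sq_abs, ← hN, ← hm, hPdef]
    ring
  have hPG : P ≤ C * ‖grad u‖ ^ 2 := by
    obtain ⟨r, hr⟩ := hP u
    rw [hsq] at hr
    nlinarith [mul_nonneg (sq_nonneg (r - m)) hN0.le]
  have hnorm : ‖u‖ * ‖u‖ = P + m ^ 2 * N + ‖grad u‖ ^ 2 := by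
    rw [← sq, norm_sq_H1, hPdef]
    ring
  rw [mul_assoc, hnorm]
  refine (min_mul_le_of_le_mul hα hC hlam hlamC (by positivity) (by positivity) hPG).trans_eq ?_
  rw [hPdef]
  ring

/-- Every positive number that is small compared with the reciprocal of the Poincaré constant lies
in the resolvent set of the Neumann problem. -/
theorem IsAdmissibleDomain.exists_isRegular {d : ℕ} {Ω : Set (E d)}
    (hΩ : IsAdmissibleDomain Ω) {α : ℝ} (hα : 0 < α) :
    ∃ lam₀ : ℝ, 0 < lam₀ ∧ ∀ lam : ℝ, 0 < lam → lam < lam₀ →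
      IsRegular Ω (fun _ => α) (fun _ => 0) lam := by
  have := completeSpace_H1 Ω
  obtain ⟨e, he, hge⟩ := exists_H1_of_contDiff (Ω := Ω) hΩ.isBounded (f := fun _ => 1)
    (G := fun _ => 0) contDiff_const continuous_const (by simp)
  have hge0 : grad e = 0 := (Lp.eq_zero_iff_ae_eq_zero).2 hge
  obtain ⟨C, hC, hP⟩ := hΩ.exists_norm_sub_sq_le he
  have he0 : val e ≠ 0 := by
    intro h0
    have h1 := (Lp.eq_zero_iff_ae_eq_zero).1 h0
    have hne : vol Ω ≠ 0 := by
      rw [Ne, Measure.restrict_eq_zero]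
      exact (hΩ.isOpen.measure_pos volume hΩ.isConnected.nonempty).ne'
    have := (ae_neBot.2 hne)
    obtain ⟨x, hx1, hx2⟩ := (h1.and he).exists
    rw [hx1] at hx2
    simp at hx2
  refine ⟨α / (2 * C), by positivity, fun lam hlam hlam' ℓ => ?_⟩
  rw [lt_div_iff₀ (by positivity)] at hlam'
  simp_rw [← formL_apply]
  exact existsUnique_of_isCoercive_comp (reflectMean_reflectMean he0)
    (isCoercive_formL_reflectMean he0 hge0 hC hP hα hlam hlam') ℓ

/-! ### Functions orthogonal to `H¹₀(Ω)` in the weak form -/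

theorem grad_eq_zero_of_val_eq_zero {d : ℕ} {Ω : Set (E d)} (hΩ : IsOpen Ω) {u : H1 Ω}
    (h : val u = 0) : grad u = 0 := by
  have hloc : LocallyIntegrableOn (grad u) Ω volume :=
    locallyIntegrableOn_of_locallyIntegrable_restrict
      ((Lp.memLp (grad u)).locallyIntegrable (by norm_num))
  have h1 := hΩ.ae_eq_zero_of_integral_contDiff_smul_eq_zero hloc fun ψ hψ hψc hψΩ => ?_
  · exact (Lp.eq_zero_iff_ae_eq_zero).2 ((ae_restrict_iff' hΩ.measurableSet).2 h1)
  · have htest : IsTest Ω ψ := ⟨hψ, hψc, hψΩ⟩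
    rw [← setIntegral_eq_integral_of_forall_compl_eq_zero (s := Ω) (μ := volume)
      (f := fun x => ψ x • grad u x) fun x hx => by
        rw [image_eq_zero_of_notMem_tsupport fun h => hx (hψΩ h), zero_smul]]
    have hi : Integrable (fun x => ψ x • grad u x) (vol Ω) :=
      memLp_one_iff_integrable.1 ((Lp.memLp (grad u)).smul htest.memLp)
    refine ext_inner_right ℝ fun v => ?_
    rw [inner_zero_left, real_inner_comm, ← integral_inner hi]
    have h2 : ∫ x in Ω, val u x * fderiv ℝ ψ x v = - ∫ x in Ω, ⟪grad u x, v⟫ * ψ x :=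
      u.2 ψ htest v
    have h3 : ∫ x in Ω, val u x * fderiv ℝ ψ x v = 0 := by
      rw [h]
      refine integral_eq_zero_of_ae ?_
      filter_upwards [Lp.coeFn_zero ℝ 2 (vol Ω)] with x hx
      rw [hx]
      simp
    rw [h3, eq_comm, neg_eq_zero] at h2
    rw [← h2]
    refine integral_congr_ae (Filter.Eventually.of_forall fun x => ?_)
    simp only [inner_smul_right, real_inner_comm v]
    ring

theorem grad_eq_of_val_eq {d : ℕ} {Ω : Set (E d)} (hΩ : IsOpen Ω) {u w : H1 Ω}
    (h : val u = val w) : grad u = grad w := by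
  have h1 := grad_eq_zero_of_val_eq_zero hΩ (u := u - w) (by
    rw [← valL_apply, map_sub, valL_apply, valL_apply, h, sub_self])
  rw [← gradL_apply, map_sub] at h1
  exact sub_eq_zero.1 h1

theorem IsTest.grad_ae_eq {d : ℕ} {Ω : Set (E d)} (hΩ : IsOpen Ω)
    (hΩb : Bornology.IsBounded Ω) {ψ : E d → ℝ} (hψ : IsTest Ω ψ) {v : H1 Ω}
    (hv : val v =ᵐ[vol Ω] ψ) : grad v =ᵐ[vol Ω] gradient ψ := by
  have hc : Continuous (gradient ψ) :=
    (LinearIsometryEquiv.continuous _).comp (hψ.1.continuous_fderiv (by simp))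
  obtain ⟨u, hu, hgu⟩ := exists_H1_of_contDiff hΩb (hψ.1.of_le (by simp)) hc
    (fun x v => by rw [gradient, InnerProductSpace.toDual_symm_apply])
  rwa [grad_eq_of_val_eq hΩ (Lp.ext (hv.trans hu.symm))]

/-- `u` is a weak solution of `-α Δu = lam u` in `Ω`, without any boundary condition. -/
def IsWeakSolution {d : ℕ} (Ω : Set (E d)) (α lam : ℝ) (u : H1 Ω) : Prop :=
  ∀ v ∈ H10 Ω, form Ω (fun _ => α) (fun _ => 0) lam u v = 0

theorem isWeakSolution_of_test {d : ℕ} {Ω : Set (E d)} {α lam : ℝ} {u : H1 Ω}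
    (h : ∀ (v : H1 Ω) (ψ : E d → ℝ), IsTest Ω ψ → val v =ᵐ[vol Ω] ψ →
      form Ω (fun _ => α) (fun _ => 0) lam u v = 0) : IsWeakSolution Ω α lam u := by
  have hle : H10 Ω ≤ (formL Ω α lam u).ker := by
    refine Submodule.topologicalClosure_minimal _ (Submodule.span_le.2 ?_)
      (formL Ω α lam u).isClosed_ker
    rintro v ⟨ψ, hψ, hv⟩
    exact (formL_apply α lam u v).trans (h v ψ hψ hv)
  intro v hv
  rw [← formL_apply]
  exact hle hv

/-- Alessandrini's identity for the linearized problem. If the linearized Neumann-to-Dirichlet data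
vanish for Neumann data with dense span, then the weak form of the perturbation vanishes on all
pairs of weak solutions. The argument is by duality: with the adjoint state `z`, the pairing of the
perturbation with the state of Neumann data `ψ` is `ψ (tr z)`, which vanishes for the given Neumann
data and hence for all of them. -/
theorem integral_eq_zero_of_isLinearizedData {d : ℕ} {Ω : Set (E d)} {φ : ℕ → HMinusHalf Ω}
    (hφ : Dense (Submodule.span ℝ (Set.range φ) : Set (HMinusHalf Ω))) {α lam : ℝ}
    (hreg : IsRegular Ω (fun _ => α) (fun _ => 0) lam) {a c : E d → ℝ}
    (hdata : ∀ n, IsLinearizedData Ω (fun _ => α) (fun _ => 0) lam (φ n) a c 0) {u w : H1 Ω}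
    (hu : IsWeakSolution Ω α lam u) (hw : IsWeakSolution Ω α lam w)
    (haw : MemLp (fun x => a x • grad w x) 2 (vol Ω))
    (hcw : MemLp (fun x => c x * val w x) 2 (vol Ω)) :
    ∫ x in Ω, (a x * ⟪grad u x, grad w x⟫ + c x * val u x * val w x) = 0 := by
  let Ψ : H1 Ω →L[ℝ] ℝ := (innerSL ℝ haw.toLp).comp (gradL Ω) + (innerSL ℝ hcw.toLp).comp (valL Ω)
  have hΨ : ∀ v : H1 Ω, Ψ v =
      ∫ x in Ω, (a x * ⟪grad v x, grad w x⟫ + c x * val v x * val w x) := by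
    intro v
    change ⟪haw.toLp, grad v⟫ + ⟪hcw.toLp, val v⟫ = _
    rw [L2.inner_def, L2.inner_def,
      ← integral_add (L2.integrable_inner _ _) (L2.integrable_inner _ _)]
    refine integral_congr_ae ?_
    filter_upwards [haw.coeFn_toLp, hcw.coeFn_toLp] with x h1 h2
    rw [h1, h2, inner_eq_mul_real, inner_smul_left, real_inner_comm]
    simp only [conj_trivial]
    ring
  obtain ⟨z, hz, -⟩ := hreg Ψ
  have hstate : ∀ (ψ : HMinusHalf Ω) (v : H1 Ω), IsState Ω (fun _ => α) (fun _ => 0) lam ψ v →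
      Ψ v = ψ (tr z) := by
    intro ψ v hv
    exact (hz v).symm.trans ((form_const_comm α lam z v).trans (hv z))
  have hn : ∀ n, φ n (tr z) = 0 := by
    intro n
    obtain ⟨u₀, du, hu₀, hdu, htr⟩ := hdata n
    have hdu0 : du ∈ H10 Ω := (Submodule.Quotient.mk_eq_zero _).1 htr
    have h1 := hdu w
    rw [form_const_comm, hw du hdu0, zero_add, ← hΨ] at h1
    rw [← hstate (φ n) u₀ hu₀, h1]
  have hall : ∀ ψ : HMinusHalf Ω, ψ (tr z) = 0 := by
    have hspan : (Submodule.span ℝ (Set.range φ) : Set (HMinusHalf Ω)) ⊆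
        {ψ : HMinusHalf Ω | ψ (tr z) = 0} := by
      intro ψ hψ
      induction hψ using Submodule.span_induction with
      | mem ψ h => obtain ⟨n, rfl⟩ := h; exact hn n
      | zero => rfl
      | add ψ ψ' _ _ h h' => exact (congrArg₂ (· + ·) h h').trans (add_zero 0)
      | smul r ψ _ h => exact (congrArg (r * ·) h).trans (mul_zero r)
    intro ψ
    exact closure_minimal hspan (isClosed_eq (continuous_eval_const (tr z)) continuous_const) (hφ ψ)
  let ψ : HMinusHalf Ω := (H10 Ω).liftQL (formL Ω α lam u) fun v hv =>
    (formL_apply α lam u v).trans (hu v hv)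
  rw [← hΨ, hstate ψ u fun v => (formL_apply α lam u v).symm, hall]

/-! ### Exponential solutions -/

/-- The real part of the exponential `x ↦ exp (⟪p, x⟫ + i (⟪r, x⟫ + θ))`. -/
def expWave {d : ℕ} (p r : E d) (θ : ℝ) (x : E d) : ℝ :=
  Real.exp ⟪p, x⟫ * Real.cos (⟪r, x⟫ + θ)

/-- The gradient of `expWave p r θ`; a shift of the phase by `-π / 2` turns the cosine into a
sine. -/
def expWaveGrad {d : ℕ} (p r : E d) (θ : ℝ) (x : E d) : E d :=
  expWave p r θ x • p - expWave p r (θ - Real.pi / 2) x • r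

theorem contDiff_expWave {d : ℕ} (p r : E d) (θ : ℝ) : ContDiff ℝ 1 (expWave p r θ) :=
  (Real.contDiff_exp.comp (contDiff_const.inner ℝ contDiff_id)).mul
    (Real.contDiff_cos.comp ((contDiff_const.inner ℝ contDiff_id).add contDiff_const))

theorem continuous_expWaveGrad {d : ℕ} (p r : E d) (θ : ℝ) : Continuous (expWaveGrad p r θ) :=
  ((contDiff_expWave p r θ).continuous.smul continuous_const).sub
    ((contDiff_expWave p r _).continuous.smul continuous_const)

theorem expWave_sub_pi_div_two {d : ℕ} (p r : E d) (θ : ℝ) (x : E d) :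
    expWave p r (θ - Real.pi / 2) x = Real.exp ⟪p, x⟫ * Real.sin (⟪r, x⟫ + θ) := by
  rw [expWave, ← add_sub_assoc, Real.cos_sub_pi_div_two]

theorem expWave_sub_pi_div_two_sub_pi_div_two {d : ℕ} (p r : E d) (θ : ℝ) (x : E d) :
    expWave p r (θ - Real.pi / 2 - Real.pi / 2) x = - expWave p r θ x := by
  rw [sub_sub, add_halves, expWave, expWave, ← add_sub_assoc, Real.cos_sub_pi]
  ring

theorem fderiv_expWave {d : ℕ} (p r : E d) (θ : ℝ) (x v : E d) :
    fderiv ℝ (expWave p r θ) x v = ⟪expWaveGrad p r θ x, v⟫ := by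
  have h1 : HasFDerivAt (fun x : E d => ⟪p, x⟫) (innerSL ℝ p) x := (innerSL ℝ p).hasFDerivAt
  have h2 : HasFDerivAt (fun x : E d => ⟪r, x⟫ + θ) (innerSL ℝ r) x :=
    (innerSL ℝ r).hasFDerivAt.add_const θ
  have h3 := (h1.exp.mul h2.cos).fderiv
  have h4 : fderiv ℝ (expWave p r θ) x = _ := h3
  rw [h4, expWaveGrad, expWave_sub_pi_div_two, expWave]
  simp only [add_apply, smul_apply, innerSL_apply_apply,
    smul_eq_mul, inner_sub_left, inner_smul_left, conj_trivial]
  ring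

/-- `u` is the restriction of `expWave p r θ` to `Ω`. -/
def IsExpWave {d : ℕ} {Ω : Set (E d)} (p r : E d) (θ : ℝ) (u : H1 Ω) : Prop :=
  val u =ᵐ[vol Ω] expWave p r θ ∧ grad u =ᵐ[vol Ω] expWaveGrad p r θ

theorem exists_isExpWave {d : ℕ} {Ω : Set (E d)} (hΩb : Bornology.IsBounded Ω) (p r : E d)
    (θ : ℝ) : ∃ u : H1 Ω, IsExpWave p r θ u :=
  exists_H1_of_contDiff hΩb (contDiff_expWave p r θ) (continuous_expWaveGrad p r θ)
    (fderiv_expWave p r θ)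

/-- If `p` and `r` are orthogonal, then `Δ (expWave p r θ) = (‖p‖² - ‖r‖²) expWave p r θ`. -/
theorem IsExpWave.isWeakSolution {d : ℕ} {Ω : Set (E d)} (hΩ : IsOpen Ω)
    (hΩb : Bornology.IsBounded Ω) {α lam : ℝ} {p r : E d} {θ : ℝ} {u : H1 Ω}
    (hu : IsExpWave p r θ u) (hpr : ⟪p, r⟫ = 0) (hlam : α * (‖r‖ ^ 2 - ‖p‖ ^ 2) = lam) :
    IsWeakSolution Ω α lam u := by
  refine isWeakSolution_of_test fun v ψ hψ hv => ?_
  obtain ⟨u', hu', hgu'⟩ := exists_isExpWave hΩb p r (θ - Real.pi / 2)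
  have hgv := hψ.grad_ae_eq hΩ hΩb hv
  have hrp : ⟪r, p⟫ = 0 := by rw [real_inner_comm, hpr]
  -- The components of the gradient are exponentials, whose own weak gradients are known.
  have h1 : ∫ x in Ω, val u x * fderiv ℝ ψ x p = - ∫ x in Ω, ⟪grad u x, p⟫ * ψ x := u.2 ψ hψ p
  have h2 : ∫ x in Ω, val u' x * fderiv ℝ ψ x r = - ∫ x in Ω, ⟪grad u' x, r⟫ * ψ x := u'.2 ψ hψ r
  have h3 : ∫ x in Ω, ⟪grad u x, p⟫ * ψ x = ‖p‖ ^ 2 * ⟪val u, val v⟫ := by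
    rw [L2.inner_def, ← integral_const_mul]
    refine integral_congr_ae ?_
    filter_upwards [hu.1, hu.2, hv] with x e1 e2 e3
    rw [e1, e2, e3, inner_eq_mul_real, expWaveGrad, inner_sub_left, inner_smul_left,
      inner_smul_left, hrp, real_inner_self_eq_norm_sq]
    simp only [conj_trivial]
    ring
  have h4 : ∫ x in Ω, ⟪grad u' x, r⟫ * ψ x = ‖r‖ ^ 2 * ⟪val u, val v⟫ := by
    rw [L2.inner_def, ← integral_const_mul]
    refine integral_congr_ae ?_
    filter_upwards [hu.1, hgu', hv] with x e1 e2 e3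
    rw [e1, e2, e3, inner_eq_mul_real, expWaveGrad,
      expWave_sub_pi_div_two_sub_pi_div_two, inner_sub_left, inner_smul_left,
      inner_smul_left, hpr, real_inner_self_eq_norm_sq]
    simp only [conj_trivial]
    ring
  have h5 : ⟪grad u, grad v⟫ =
      (∫ x in Ω, val u x * fderiv ℝ ψ x p) - ∫ x in Ω, val u' x * fderiv ℝ ψ x r := by
    rw [L2.inner_def, ← integral_sub (hψ.integrable_left p _) (hψ.integrable_left r _)]
    refine integral_congr_ae ?_
    filter_upwards [hu.1, hu.2, hu', hgv] with x e1 e2 e3 e4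
    rw [e1, e2, e3, e4, expWaveGrad, inner_sub_left, inner_smul_left, inner_smul_left,
      inner_gradient_right, inner_gradient_right]
    simp only [conj_trivial]
  rw [form_const, h5, h1, h2, h3, h4, ← hlam]
  ring

/-- The differences below are the real parts of products of complex exponentials. -/
theorem expWave_mul_sub {d : ℕ} (p r r' : E d) (θ : ℝ) (x : E d) :
    expWave p r θ x * expWave (-p) r' 0 x -
      expWave p r (θ - Real.pi / 2) x * expWave (-p) r' (0 - Real.pi / 2) x =
    Real.cos (⟪r + r', x⟫ + θ) := by
  rw [expWave_sub_pi_div_two, expWave_sub_pi_div_two, expWave, expWave]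
  have h1 : Real.exp ⟪p, x⟫ * Real.exp ⟪-p, x⟫ = 1 := by
    rw [← Real.exp_add, inner_neg_left, add_neg_cancel, Real.exp_zero]
  have h2 : ⟪r + r', x⟫ + θ = (⟪r, x⟫ + θ) + (⟪r', x⟫ + 0) := by rw [inner_add_left]; ring
  rw [h2, Real.cos_add (⟪r, x⟫ + θ)]
  linear_combination (Real.cos (⟪r, x⟫ + θ) * Real.cos (⟪r', x⟫ + 0) -
    Real.sin (⟪r, x⟫ + θ) * Real.sin (⟪r', x⟫ + 0)) * h1

theorem inner_expWaveGrad_sub {d : ℕ} {p r r' : E d} (hpr : ⟪p, r⟫ = 0) (hpr' : ⟪p, r'⟫ = 0)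
    (θ : ℝ) (x : E d) :
    ⟪expWaveGrad p r θ x, expWaveGrad (-p) r' 0 x⟫ -
      ⟪expWaveGrad p r (θ - Real.pi / 2) x, expWaveGrad (-p) r' (0 - Real.pi / 2) x⟫ =
    -(‖p‖ ^ 2 + ⟪r, r'⟫) * Real.cos (⟪r + r', x⟫ + θ) := by
  have hrp : ⟪r, p⟫ = 0 := by rw [real_inner_comm, hpr]
  rw [← expWave_mul_sub p r r' θ x]
  simp only [expWaveGrad, expWave_sub_pi_div_two_sub_pi_div_two, inner_sub_left,
    inner_sub_right, inner_smul_left, inner_smul_right,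
    conj_trivial, inner_neg_right, hpr', hrp, real_inner_self_eq_norm_sq]
  ring

/-! ### Vanishing of the perturbation -/

theorem IsExpWave.memLp_smul_grad {d : ℕ} {Ω : Set (E d)} (hΩb : Bornology.IsBounded Ω)
    {p r : E d} {θ : ℝ} {w : H1 Ω} (hw : IsExpWave p r θ w) (a : Linf Ω) :
    MemLp (fun x => a x • grad w x) 2 (vol Ω) := by
  have h1 : MemLp (expWaveGrad p r θ) 2 (vol Ω) :=
    memLp_of_continuous hΩb (continuous_expWaveGrad p r θ) 2
  refine (h1.smul (Lp.memLp a)).ae_eq ?_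
  filter_upwards [hw.2] with x hx
  rw [hx]
  rfl

theorem IsExpWave.memLp_mul_val {d : ℕ} {Ω : Set (E d)} (hΩb : Bornology.IsBounded Ω)
    {p r : E d} {θ : ℝ} {w : H1 Ω} (hw : IsExpWave p r θ w) (c : L2 Ω) :
    MemLp (fun x => c x * val w x) 2 (vol Ω) := by
  have h1 : MemLp (expWave p r θ) ⊤ (vol Ω) :=
    memLp_of_continuous hΩb (contDiff_expWave p r θ).continuous ⊤
  refine (h1.mul (Lp.memLp c)).ae_eq ?_
  filter_upwards [hw.1] with x hx
  rw [hx]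
  rfl

theorem integrable_coeff_mul_cos {d : ℕ} {Ω : Set (E d)} {f : E d → ℝ}
    (hf : Integrable f (vol Ω)) (ζ : E d) (θ : ℝ) :
    Integrable (fun x => f x * Real.cos (⟪ζ, x⟫ + θ)) (vol Ω) :=
  hf.mul_bdd (c := 1) (by fun_prop) (Filter.Eventually.of_forall fun x => by
    rw [Real.norm_eq_abs]
    exact Real.abs_cos_le_one _)

/-- Testing the vanishing perturbation with exponential solutions whose product is a plane wave. -/
theorem integral_mul_cos_eq_zero {d : ℕ} {Ω : Set (E d)} (hΩ : IsOpen Ω)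
    (hΩb : Bornology.IsBounded Ω) {φ : ℕ → HMinusHalf Ω}
    (hφ : Dense (Submodule.span ℝ (Set.range φ) : Set (HMinusHalf Ω))) {α lam : ℝ}
    (hreg : IsRegular Ω (fun _ => α) (fun _ => 0) lam) {a : Linf Ω} {c : L2 Ω}
    (hdata : ∀ n, IsLinearizedData Ω (fun _ => α) (fun _ => 0) lam (φ n) a c 0) {p r r' : E d}
    (hpr : ⟪p, r⟫ = 0) (hpr' : ⟪p, r'⟫ = 0) (hr : α * (‖r‖ ^ 2 - ‖p‖ ^ 2) = lam)
    (hr' : α * (‖r'‖ ^ 2 - ‖p‖ ^ 2) = lam) (θ : ℝ) :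
    ∫ x in Ω, (c x - (‖p‖ ^ 2 + ⟪r, r'⟫) * a x) * Real.cos (⟪r + r', x⟫ + θ) = 0 := by
  have hpr'' : ⟪-p, r'⟫ = 0 := by rw [inner_neg_left, hpr', neg_zero]
  have hr'' : α * (‖r'‖ ^ 2 - ‖-p‖ ^ 2) = lam := by rw [norm_neg, hr']
  have key : ∀ t t' : ℝ, Integrable (fun x =>
        a x * ⟪expWaveGrad p r t x, expWaveGrad (-p) r' t' x⟫ +
        c x * (expWave p r t x * expWave (-p) r' t' x)) (vol Ω) ∧
      ∫ x in Ω, (a x * ⟪expWaveGrad p r t x, expWaveGrad (-p) r' t' x⟫ +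
        c x * (expWave p r t x * expWave (-p) r' t' x)) = 0 := by
    intro t t'
    obtain ⟨u, hu⟩ := exists_isExpWave hΩb p r t
    obtain ⟨w, hw⟩ := exists_isExpWave hΩb (-p) r' t'
    have haw := hw.memLp_smul_grad hΩb a
    have hcw := hw.memLp_mul_val hΩb c
    have h0 := integral_eq_zero_of_isLinearizedData hφ hreg hdata
      (hu.isWeakSolution hΩ hΩb hpr hr) (hw.isWeakSolution hΩ hΩb hpr'' hr'') haw hcw
    have hcongr : (fun x => a x * ⟪grad u x, grad w x⟫ + c x * val u x * val w x) =ᵐ[vol Ω]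
        fun x => a x * ⟪expWaveGrad p r t x, expWaveGrad (-p) r' t' x⟫ +
        c x * (expWave p r t x * expWave (-p) r' t' x) := by
      filter_upwards [hu.1, hu.2, hw.1, hw.2] with x e1 e2 e3 e4
      rw [e1, e2, e3, e4, mul_assoc (c x)]
    have hint : Integrable (fun x => a x * ⟪grad u x, grad w x⟫ + c x * val u x * val w x)
        (vol Ω) := by
      have i1 := L2.integrable_inner (𝕜 := ℝ) haw.toLp (grad u)
      have i2 := hcw.integrable_mul (Lp.memLp (val u))
      refine (i1.add i2).congr ?_
      filter_upwards [haw.coeFn_toLp] with x hx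
      rw [Pi.add_apply, hx, Pi.mul_apply, inner_smul_left, conj_trivial, real_inner_comm]
      ring
    exact ⟨hint.congr hcongr, (integral_congr_ae hcongr).symm.trans h0⟩
  obtain ⟨i1, h1⟩ := key θ 0
  obtain ⟨i2, h2⟩ := key (θ - Real.pi / 2) (0 - Real.pi / 2)
  have h3 := integral_sub i1 i2
  rw [h1, h2, sub_zero] at h3
  rw [← h3]
  refine integral_congr_ae (Filter.Eventually.of_forall fun x => ?_)
  simp only
  linear_combination (-c x) * expWave_mul_sub p r r' θ x -
    a x * inner_expWaveGrad_sub hpr hpr' θ x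

theorem exists_unit_inner_eq_zero {d : ℕ} (hd : 2 ≤ d) (ζ : E d) :
    ∃ η : E d, ‖η‖ = 1 ∧ ⟪ζ, η⟫ = 0 := by
  have h1 : Module.finrank ℝ (Submodule.span ℝ {ζ}) ≤ 1 := 
    (finrank_span_le_card ({ζ} : Set (E d))).trans (by simp)
  have h2 := Submodule.finrank_add_finrank_orthogonal (Submodule.span ℝ {ζ})
  rw [finrank_euclideanSpace_fin] at h2
  have h3 : (Submodule.span ℝ {ζ})ᗮ ≠ ⊥ := by
    intro h
    rw [h, finrank_bot] at h2
    omega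
  obtain ⟨η, hη, hη0⟩ := Submodule.exists_mem_ne_zero_of_ne_bot h3
  refine ⟨(‖η‖⁻¹ : ℝ) • η, norm_smul_inv_norm (𝕜 := ℝ) hη0, ?_⟩
  rw [inner_smul_right, Submodule.mem_orthogonal_singleton_iff_inner_right.1 hη, mul_zero]

/-- Every vector `ζ` is the sum of the frequencies `r - i p` and `r' + i p` of two exponential
solutions of `-Δu = μ u`: two plane waves for low frequencies `ζ`, an exponentially growing and
an exponentially decaying solution for high frequencies. -/
theorem exists_frequencies {d : ℕ} (hd : 2 ≤ d) (ζ : E d) (μ : ℝ) :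
    ∃ p r r' : E d, r + r' = ζ ∧ ⟪p, r⟫ = 0 ∧ ⟪p, r'⟫ = 0 ∧ ‖r‖ ^ 2 - ‖p‖ ^ 2 = μ ∧
      ‖r'‖ ^ 2 - ‖p‖ ^ 2 = μ ∧ ‖p‖ ^ 2 + ⟪r, r'⟫ = ‖ζ‖ ^ 2 / 2 - μ := by
  obtain ⟨η, hη, hζη⟩ := exists_unit_inner_eq_zero hd ζ
  have hηη : ⟪η, η⟫ = (1 : ℝ) := by rw [real_inner_self_eq_norm_sq, hη]; norm_num
  have hηζ : ⟪η, ζ⟫ = 0 := by rw [real_inner_comm, hζη]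
  simp only [← real_inner_self_eq_norm_sq]
  rcases le_total 0 (μ - ⟪ζ, ζ⟫ / 4) with h | h
  · set σ := Real.sqrt (μ - ⟪ζ, ζ⟫ / 4)
    have hσ : σ ^ 2 = μ - ⟪ζ, ζ⟫ / 4 := Real.sq_sqrt h
    refine ⟨0, (1 / 2 : ℝ) • ζ + σ • η, (1 / 2 : ℝ) • ζ - σ • η, by module, by simp, by simp,
      ?_, ?_, ?_⟩ <;>
    · simp only [inner_add_left, inner_add_right, inner_sub_left, inner_sub_right, inner_smul_left,
        inner_smul_right, hζη, hηζ, hηη, conj_trivial, inner_zero_left]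
      linarith
  · set κ := Real.sqrt (-(μ - ⟪ζ, ζ⟫ / 4))
    have hκ : κ ^ 2 = -(μ - ⟪ζ, ζ⟫ / 4) := Real.sq_sqrt (by linarith)
    refine ⟨κ • η, (1 / 2 : ℝ) • ζ, (1 / 2 : ℝ) • ζ, by module, ?_, ?_, ?_, ?_, ?_⟩ <;>
    · simp only [inner_smul_left, inner_smul_right, hηζ, hηη, conj_trivial]
      linarith

/-- An integrable function whose Fourier transform vanishes is zero. -/
theorem ae_eq_zero_of_integral_mul_cos {d : ℕ} {Ω : Set (E d)} {f : E d → ℝ}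
    (hf : Integrable f (vol Ω))
    (h : ∀ (ζ : E d) (θ : ℝ), ∫ x in Ω, f x * Real.cos (⟪ζ, x⟫ + θ) = 0) :
    f =ᵐ[vol Ω] 0 := by
  have hm : AEMeasurable (fun x => ENNReal.ofReal (f x)) (vol Ω) :=
    hf.aestronglyMeasurable.aemeasurable.ennreal_ofReal
  have hm' : AEMeasurable (fun x => ENNReal.ofReal (-f x)) (vol Ω) :=
    hf.neg.aestronglyMeasurable.aemeasurable.ennreal_ofReal
  have hfin : IsFiniteMeasure ((vol Ω).withDensity fun x => ENNReal.ofReal (f x)) :=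
    isFiniteMeasure_withDensity_ofReal hf.2
  have hfin' : IsFiniteMeasure ((vol Ω).withDensity fun x => ENNReal.ofReal (-f x)) :=
    isFiniteMeasure_withDensity_ofReal hf.neg.2
  have heq : ((vol Ω).withDensity fun x => ENNReal.ofReal (f x)) =
      (vol Ω).withDensity fun x => ENNReal.ofReal (-f x) := by
    refine Measure.ext_of_charFun (funext fun ζ => ?_)
    have hexp : ∀ x, ‖Complex.exp (⟪x, ζ⟫ * Complex.I)‖ ≤ 1 := fun x =>
      (Complex.norm_exp_ofReal_mul_I _).le
    have hi : ∀ {g : E d → ℝ}, Integrable g (vol Ω) →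
        Integrable (fun x => (g x) • Complex.exp (⟪x, ζ⟫ * Complex.I)) (vol Ω) := fun hg => by
      simp only [Complex.real_smul]
      exact hg.ofReal.mul_bdd (c := 1) (by fun_prop) (Filter.Eventually.of_forall hexp)
    rw [charFun_apply, charFun_apply,
      integral_withDensity_eq_integral_toReal_smul₀ hm
        (Filter.Eventually.of_forall fun x => by simp),
      integral_withDensity_eq_integral_toReal_smul₀ hm'
        (Filter.Eventually.of_forall fun x => by simp), ← sub_eq_zero]
    simp only [ENNReal.toReal_ofReal']
    rw [← integral_sub (hi hf.pos_part) (hi hf.neg_part)]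
    have hsub : ∀ x, max (f x) 0 • Complex.exp (⟪x, ζ⟫ * Complex.I) -
        max (-f x) 0 • Complex.exp (⟪x, ζ⟫ * Complex.I) =
        ((f x * Real.cos (⟪ζ, x⟫ + 0) : ℝ) : ℂ) +
          ((f x * Real.cos (⟪ζ, x⟫ + -(Real.pi / 2)) : ℝ) : ℂ) * Complex.I := by
      intro x
      have h1 : max (f x) 0 - max (-f x) 0 = f x := max_zero_sub_max_neg_zero_eq_self (f x)
      rw [← sub_smul, h1, ← sub_eq_add_neg, Real.cos_sub_pi_div_two, Complex.exp_mul_I,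
        real_inner_comm, add_zero, Complex.real_smul]
      push_cast
      ring
    simp only [hsub]
    rw [integral_add ((integrable_coeff_mul_cos hf ζ 0).ofReal)
      ((integrable_coeff_mul_cos hf ζ _).ofReal.mul_const _), integral_mul_const,
      integral_complex_ofReal, integral_complex_ofReal, h, h]
    simp
  have hae := (withDensity_eq_iff hm hm' (by
    have := hfin.1
    rw [withDensity_apply _ MeasurableSet.univ, Measure.restrict_univ] at this
    exact this.ne)).1 heq
  filter_upwards [hae] with x hx
  have h1 := congrArg ENNReal.toReal hx
  simp only [ENNReal.toReal_ofReal'] at h1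
  have h2 := max_zero_sub_max_neg_zero_eq_self (f x)
  rw [h1, sub_self] at h2
  exact h2.symm

/-- The data at two regular values of the parameter determine both coefficients: the two equations
for the Fourier transforms of `a` and `c` at each frequency are linearly independent. -/
theorem eq_zero_of_isLinearizedData {d : ℕ} (hd : 2 ≤ d) {Ω : Set (E d)} (hΩ : IsOpen Ω)
    (hΩb : Bornology.IsBounded Ω) {φ : ℕ → HMinusHalf Ω}
    (hφ : Dense (Submodule.span ℝ (Set.range φ) : Set (HMinusHalf Ω))) {α : ℝ} (hα : 0 < α)
    {lam lam' : ℝ} (hne : lam ≠ lam') (hreg : IsRegular Ω (fun _ => α) (fun _ => 0) lam)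
    (hreg' : IsRegular Ω (fun _ => α) (fun _ => 0) lam') {a : Linf Ω} {c : L2 Ω}
    (hdata : ∀ n, IsLinearizedData Ω (fun _ => α) (fun _ => 0) lam (φ n) a c 0)
    (hdata' : ∀ n, IsLinearizedData Ω (fun _ => α) (fun _ => 0) lam' (φ n) a c 0) :
    a = 0 ∧ c = 0 := by
  have : IsFiniteMeasure (vol Ω) := ⟨by simpa using hΩb.measure_lt_top⟩
  have hai : Integrable a (vol Ω) := (Lp.memLp a).integrable le_top
  have hci : Integrable c (vol Ω) := (Lp.memLp c).integrable (by norm_num)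
  have key : ∀ (ζ : E d) (θ t : ℝ), IsRegular Ω (fun _ => α) (fun _ => 0) t →
      (∀ n, IsLinearizedData Ω (fun _ => α) (fun _ => 0) t (φ n) a c 0) →
      (∫ x in Ω, c x * Real.cos (⟪ζ, x⟫ + θ)) -
        (‖ζ‖ ^ 2 / 2 - t / α) * ∫ x in Ω, a x * Real.cos (⟪ζ, x⟫ + θ) = 0 := by
    intro ζ θ t ht hdt
    obtain ⟨p, r, r', hsum, hpr, hpr', hr, hr', hprod⟩ := exists_frequencies hd ζ (t / α)
    have h1 := integral_mul_cos_eq_zero hΩ hΩb hφ ht hdt hpr hpr'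
      (by rw [hr]; field_simp) (by rw [hr']; field_simp) θ
    rw [hprod, hsum] at h1
    rw [← integral_const_mul, ← integral_sub (integrable_coeff_mul_cos hci ζ θ)
      ((integrable_coeff_mul_cos hai ζ θ).const_mul _), ← h1]
    refine integral_congr_ae (Filter.Eventually.of_forall fun x => ?_)
    simp only
    ring
  have ha0 : ∀ (ζ : E d) (θ : ℝ), ∫ x in Ω, a x * Real.cos (⟪ζ, x⟫ + θ) = 0 := by
    intro ζ θ
    have h1 := key ζ θ lam hreg hdata
    have h2 := key ζ θ lam' hreg' hdata'
    have h3 : (lam / α - lam' / α) * ∫ x in Ω, a x * Real.cos (⟪ζ, x⟫ + θ) = 0 := by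
      linear_combination h1 - h2
    refine (mul_eq_zero.1 h3).resolve_left ?_
    rw [← sub_div]
    exact div_ne_zero (sub_ne_zero.2 hne) hα.ne'
  have hc0 : ∀ (ζ : E d) (θ : ℝ), ∫ x in Ω, c x * Real.cos (⟪ζ, x⟫ + θ) = 0 := by
    intro ζ θ
    have h1 := key ζ θ lam hreg hdata
    rwa [ha0, mul_zero, sub_zero] at h1
  exact ⟨(Lp.eq_zero_iff_ae_eq_zero).2 (ae_eq_zero_of_integral_mul_cos hai ha0),
    (Lp.eq_zero_iff_ae_eq_zero).2 (ae_eq_zero_of_integral_mul_cos hci hc0)⟩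

/-! ### Coefficients depending on the index -/

theorem ae_forall_of_ae_wmeas {p : ℝ × ℕ → Prop} (h : ∀ᵐ j ∂wmeas, p j) :
    ∀ᵐ lam ∂(volume.restrict (Ici (0 : ℝ))), ∀ n, p (lam, n) := by
  have hm : Measurable fun j : ℝ × ℕ => ENNReal.ofReal (weight j) := by
    unfold weight
    fun_prop
  have h1 := Measure.ae_ae_of_ae_prod ((ae_withDensity_iff hm).1 h)
  filter_upwards [h1, ae_restrict_mem measurableSet_Ici] with lam hlam hlam0 n
  have h2 : ∀ n, ENNReal.ofReal (weight (lam, n)) ≠ 0 → p (lam, n) := Measure.ae_count_iff.1 hlam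
  refine h2 n ?_
  have hlam1 : (0 : ℝ) ≤ lam := hlam0
  rw [Ne, ENNReal.ofReal_eq_zero, not_le]
  unfold weight
  positivity

theorem exists_mem_Ioo_of_ae {p : ℝ → Prop} (h : ∀ᵐ lam ∂(volume.restrict (Ici (0 : ℝ))), p lam)
    {s t : ℝ} (hs : 0 ≤ s) (hst : s < t) : ∃ lam ∈ Ioo s t, p lam := by
  have h1 : ∀ᵐ lam ∂(volume.restrict (Ioo s t)), p lam :=
    ae_restrict_of_ae_restrict_of_subset (fun x hx => hs.trans hx.1.le) h
  have h2 : NeZero (volume.restrict (Ioo s t)) := ⟨by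
    rw [Ne, Measure.restrict_eq_zero, Real.volume_Ioo, ENNReal.ofReal_eq_zero, not_le]
    linarith⟩
  obtain ⟨lam, hlam, hp⟩ := ((ae_restrict_mem measurableSet_Ioo).and h1).exists
  exact ⟨lam, hlam, hp⟩

theorem zero_mem_nullF' {d : ℕ} {Ω : Set (E d)} (φ : ℕ → HMinusHalf Ω) (a₀ c₀ : E d → ℝ) :
    (0 : Linf Ω × LiftedC Ω) ∈ nullF' Ω φ a₀ c₀ := by
  filter_upwards [Lp.coeFn_zero (L2 Ω) 2 wmeas] with j hj hreg
  obtain ⟨u, hu, -⟩ := hreg ((φ j.2).comp (H10 Ω).mkQL)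
  refine ⟨u, 0, hu, fun w => ?_, rfl⟩
  have h1 : form Ω a₀ c₀ j.1 0 w = 0 := by
    refine integral_eq_zero_of_ae ?_
    filter_upwards [Lp.coeFn_zero ℝ 2 (vol Ω), Lp.coeFn_zero (E d) 2 (vol Ω)] with x h1 h2
    have e1 : val (0 : H1 Ω) x = 0 := h1
    have e2 : grad (0 : H1 Ω) x = 0 := h2
    rw [e1, e2]
    simp
  rw [h1, zero_add]
  refine integral_eq_zero_of_ae ?_
  have e : (0 : Linf Ω × LiftedC Ω).2 j = 0 := hj
  rw [e]
  filter_upwards [Lp.coeFn_zero ℝ ⊤ (vol Ω), Lp.coeFn_zero ℝ 2 (vol Ω)] with x h1 h2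
  have e1 : (0 : Linf Ω × LiftedC Ω).1 x = 0 := h1
  rw [e1, h2]
  simp

theorem zero_mem_nullP {d : ℕ} (Ω : Set (E d)) : (0 : Linf Ω × LiftedC Ω) ∈ nullP Ω := by
  have h : ∫ j, (0 : Linf Ω × LiftedC Ω).2 j ∂wmeas = 0 :=
    integral_eq_zero_of_ae (Lp.coeFn_zero (L2 Ω) 2 wmeas)
  change penalty Ω _ = 0
  rw [penalty, h, smul_zero, map_zero, Prod.snd_zero, sub_zero]

end DiffAbs

end

theorem mainTheorem12 {d : ℕ} (hd : d = 2 ∨ d = 3) (Ω : Set (DiffAbs.E d))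
    (hΩ : DiffAbs.IsAdmissibleDomain Ω)
    (φ : ℕ → DiffAbs.HMinusHalf Ω)
    (hφ : Dense (Submodule.span ℝ (Set.range φ) : Set (DiffAbs.HMinusHalf Ω)))
    (α : ℝ) (hα : 0 < α) :
    (∀ (a : DiffAbs.Linf Ω) (c : DiffAbs.L2 Ω),
      (∀ lam : ℝ, 0 ≤ lam → DiffAbs.IsRegular Ω (fun _ => α) (fun _ => 0) lam → ∀ n : ℕ,
        DiffAbs.IsLinearizedData Ω (fun _ => α) (fun _ => 0) lam (φ n) a c 0) →
      a = 0 ∧ c = 0) ∧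
    DiffAbs.nullF' Ω φ (fun _ => α) (fun _ => 0) ∩ DiffAbs.nullP Ω = {0} := by
  have hd2 : 2 ≤ d := by omega
  obtain ⟨lam₀, hlam₀, hreg⟩ := hΩ.exists_isRegular hα
  refine ⟨fun a c h => ?_, ?_⟩
  · have h1 := hreg (lam₀ / 2) (by linarith) (by linarith)
    have h2 := hreg (lam₀ / 3) (by linarith) (by linarith)
    exact DiffAbs.eq_zero_of_isLinearizedData hd2 hΩ.isOpen hΩ.isBounded hφ hα
      (by intro h; linarith) h1 h2 (h _ (by linarith) h1) (h _ (by linarith) h2)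
  · refine Set.eq_singleton_iff_unique_mem.2
      ⟨⟨DiffAbs.zero_mem_nullF' φ _ _, DiffAbs.zero_mem_nullP Ω⟩, ?_⟩
    rintro ⟨a, c⟩ ⟨hF, hP⟩
    -- The vanishing penalty means that `c` does not depend on the index.
    obtain ⟨k, hk⟩ : ∃ k : DiffAbs.L2 Ω, c = MeasureTheory.Lp.const 2 DiffAbs.wmeas k :=
      ⟨_, sub_eq_zero.1 hP⟩
    have hck : ∀ᵐ j ∂DiffAbs.wmeas, c j = k := by
      rw [hk]
      exact MeasureTheory.Lp.coeFn_const ..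
    have hF' : ∀ᵐ j ∂DiffAbs.wmeas, DiffAbs.IsRegular Ω (fun _ => α) (fun _ => 0) j.1 →
        DiffAbs.IsLinearizedData Ω (fun _ => α) (fun _ => 0) j.1 (φ j.2) a k 0 := by
      have hF0 : ∀ᵐ j ∂DiffAbs.wmeas, DiffAbs.IsRegular Ω (fun _ => α) (fun _ => 0) j.1 →
        DiffAbs.IsLinearizedData Ω (fun _ => α) (fun _ => 0) j.1 (φ j.2) a (c j) 0 := hF
      filter_upwards [hF0, hck] with j h1 h2
      rwa [h2] at h1
    have hae := DiffAbs.ae_forall_of_ae_wmeas hF'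
    obtain ⟨lam, ⟨hl0, hl1⟩, hl⟩ :=
      DiffAbs.exists_mem_Ioo_of_ae hae le_rfl (show (0 : ℝ) < lam₀ / 2 by linarith)
    obtain ⟨lam', ⟨hl0', hl1'⟩, hl'⟩ :=
      DiffAbs.exists_mem_Ioo_of_ae hae (by linarith) (show lam₀ / 2 < lam₀ by linarith)
    have h1 := hreg lam hl0 (by linarith)
    have h2 := hreg lam' (by linarith) hl1'
    obtain ⟨ha, hk0⟩ := DiffAbs.eq_zero_of_isLinearizedData hd2 hΩ.isOpen hΩ.isBounded hφ hα
      (by linarith : lam < lam').ne h1 h2 (fun n => hl n h1) (fun n => hl' n h2)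
    rw [ha, hk, hk0, map_zero]
    rfl
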